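/- Setting. Let $\mathcal D$ be a measurable space of datasets and $R$ an arbitrary relation on $\mathcal D$; $D_1,D_2$ are called neighbouring if $R(D_1,D_2)$. A mechanism $\mathcal M$ with outputs in a measurable space $\mathcal O$ is a Markov kernel $D\mapsto\mathcal M(D)$ from $\mathcal D$ to $\mathcal O$ (if $\mathcal D$ carries the discrete $\sigma$-algebra: any family of probability distributions on $\mathcal O$). A privacy definition is a property of mechanisms. It satisfies the *post-processing axiom* if, whenever $\mathcal M$ satisfies it and $g$ is a probabilistic function (a Markov kernel from $\mathcal O$ to a measurable space $\mathcal O'$), the mechanism $D\mapsto g(\mathcal M(D))$ satisfies it; it satisfies the *convexity axiom* if, whenever $\mathcal M_1,\mathcal M_2$ (with the same output space) satisfy it and $p\in[0,1]$, the mechanism $D\mapsto p\,\mathcal M_1(D)+(1-p)\,\mathcal M_2(D)$ satisfies it. For convex $f:(0,\infty)\to\mathbb R$ with $f(1)=0$ put $f(0)=\lim_{t\to0^+}f(t)$ and $f'(\infty)=\lim_{t\to\infty}f(t)/t$, both in $(-\infty,\infty]$. For probability measures $P,Q$ let $D_f(P\|Q)=\int f\!\left(\tfrac{dP}{dQ}\right)dQ+f'(\infty)\,P_s(\mathcal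 O)$, where $\tfrac{dP}{dQ}$ is the density of the $Q$-absolutely continuous part of $P$, $P_s$ is the $Q$-singular part of $P$, and $\infty\cdot0=0$. A mechanism is $(f,\varepsilon)$-*divergence DP* if $D_f(\mathcal M(D_1)\|\mathcal M(D_2))\le\varepsilon$ for all neighbouring $D_1,D_2$. Theorem. For every convex $f:(0,\infty)\to\mathbb R$ with $f(1)=0$ and every $\varepsilon\in\mathbb R$, $(f,\varepsilon)$-divergence DP satisfies both privacy axioms. Moreover, each of the following privacy definitions satisfies both axioms, for all real values of its parameters (in (1), (3), (4), (5) the condition is required for all neighbouring $D_1,D_2$; in (4), (5), $L(O)=\ln\frac{p(O)}{q(O)}$ with $p,q$ the densities of $\mathcal M(D_1),\mathcal M(D_2)$ with respect to their sum, $L=\infty$ where only $q=0$, and $L=-\infty$ where $p=0$): 1. $(\varepsilon,\delta)$-approximate DP: $\Pr[\mathcal M(D_1)\in S]\le e^{\varepsilon}\Pr[\mathcal M(D_2)\in S]+\delta$ for all measurable $S$. 2. $\varepsilon$-mutual-information privacy, for datasets that are finite sequences of records from a nonempty standard Borel space $\mathcal T$: for every $n\ge1$, every $i\le n$ and every probability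 distribution $\theta$ on $\mathcal T^n$, if $D\sim\theta$ then $I\big(D(i);\mathcal M(D)\,\big|\,D_{-i}\big)\le\varepsilon$, where $D(i)$ is the $i$-th record and $D_{-i}$ the sequence of the other records. 3. $\varepsilon$-KL privacy: $D_{\mathrm{KL}}(\mathcal M(D_1)\|\mathcal M(D_2))\le\varepsilon$. 4. $(\alpha,\varepsilon)$-Rényi DP, $\alpha>1$: $\mathbb E_{O\sim\mathcal M(D_1)}\big[e^{(\alpha-1)L(O)}\big]\le e^{(\alpha-1)\varepsilon}$. 5. $(\xi,\rho)$-zero-concentrated DP: $\mathbb E_{O\sim\mathcal M(D_1)}\big[e^{(\alpha-1)L(O)}\big]\le e^{(\alpha-1)(\xi+\rho\alpha)}$ for all $\alpha>1$. -/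

import Mathlib

open MeasureTheory ProbabilityTheory Filter Topology InformationTheory
open scoped ENNReal

universe u v w

noncomputable section

/-! ### Privacy definitions and the two privacy axioms -/

/-- A privacy definition for mechanisms with inputs in `𝒟`: a property of mechanisms, for
mechanisms with any measurable space `O` of outputs. A mechanism is a Markov kernel from the datasets
to the outputs (with the σ-algebra `⊤` on `𝒟`, an arbitrary family of output distributions). -/
def PrivacyDefinition (𝒟 : Type u) [MeasurableSpace 𝒟] : Type (max u (v + 1)) :=
  ∀ (O : Type v) [MeasurableSpace O], Kernel 𝒟 O → Prop

/-- The mechanism that runs `M₁` with probability `p` and `M₂` with probability `1 - p`. -/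
def mixKernel {𝒟 : Type u} [MeasurableSpace 𝒟] {O : Type v} [MeasurableSpace O]
    (p : unitInterval) (M₁ M₂ : Kernel 𝒟 O) : Kernel 𝒟 O where
  toFun D := ENNReal.ofReal (p : ℝ) • M₁ D + ENNReal.ofReal (1 - (p : ℝ)) • M₂ D
  measurable' := by
    refine Measure.measurable_of_measurable_coe _ fun s hs => ?_
    simp only [Measure.coe_add, Measure.coe_smul, Pi.add_apply, Pi.smul_apply, smul_eq_mul]
    exact ((M₁.measurable_coe hs).const_mul _).add ((M₂.measurable_coe hs).const_mul _)

/-- Post-processing: applying a probabilistic function `g` (a Markov kernel) to the output of a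
mechanism that satisfies the definition gives a mechanism that satisfies it. -/
def SatisfiesPostProcessing {𝒟 : Type u} [MeasurableSpace 𝒟]
    (Def : PrivacyDefinition.{u, v} 𝒟) : Prop :=
  ∀ (O O' : Type v) [MeasurableSpace O] [MeasurableSpace O']
    (M : Kernel 𝒟 O) [IsMarkovKernel M] (g : Kernel O O') [IsMarkovKernel g],
    Def O M → Def O' (g ∘ₖ M)

/-- Convexity (privacy axiom of choice). -/
def SatisfiesConvexity {𝒟 : Type u} [MeasurableSpace 𝒟]
    (Def : PrivacyDefinition.{u, v} 𝒟) : Prop :=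
  ∀ (O : Type v) [MeasurableSpace O]
    (M₁ M₂ : Kernel 𝒟 O) [IsMarkovKernel M₁] [IsMarkovKernel M₂] (p : unitInterval),
    Def O M₁ → Def O M₂ → Def O (mixKernel p M₁ M₂)

/-- Both privacy axioms. -/
def SatisfiesPrivacyAxioms {𝒟 : Type u} [MeasurableSpace 𝒟]
    (Def : PrivacyDefinition.{u, v} 𝒟) : Prop :=
  SatisfiesPostProcessing Def ∧ SatisfiesConvexity Def

/-! ### `f`-divergences and divergence DP -/

/-- `f(0+) = lim_{t → 0+} f t`, in `(-∞, ∞]` for convex `f` (the limit exists then, and the upper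
limit is equal to it). -/
def fAtZero (f : ℝ → ℝ) : EReal := limsup (fun t : ℝ => (f t : EReal)) (𝓝[>] 0)

/-- `f'(∞) = lim_{t → ∞} f t / t`, in `(-∞, ∞]` for convex `f`. -/
def fSlopeAtTop (f : ℝ → ℝ) : EReal := limsup (fun t : ℝ => ((f t / t : ℝ) : EReal)) atTop

/-- `f` evaluated at a density ratio, with `f(0) := f(0+)`. -/
def fAtRatio (f : ℝ → ℝ) (r : ℝ≥0∞) : EReal :=
  if r = 0 then fAtZero f else (f r.toReal : EReal)

/-- The `f`-divergence `D_f(P ‖ Q) = ∫ f(dP/dQ) dQ + f'(∞) · P_s(Ω)`, where `P_s` is the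
`Q`-singular part of `P`. The integral of the extended-real function is the integral of its positive
part minus that of its negative part; the latter is finite for convex `f` and probability measures. -/
def fDivergence {O : Type v} [MeasurableSpace O] (f : ℝ → ℝ) (P Q : Measure O) : EReal :=
  (((∫⁻ x, (fAtRatio f (P.rnDeriv Q x)).toENNReal ∂Q : ℝ≥0∞) : EReal)
      - ((∫⁻ x, (-fAtRatio f (P.rnDeriv Q x)).toENNReal ∂Q : ℝ≥0∞) : EReal))
    + fSlopeAtTop f * ((P.singularPart Q Set.univ : ℝ≥0∞) : EReal)

/-- `(f, ε)`-divergence DP for the neighbouring relation `R`. -/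
def DivDP {𝒟 : Type u} [MeasurableSpace 𝒟] (R : 𝒟 → 𝒟 → Prop) (f : ℝ → ℝ) (ε : ℝ) :
    PrivacyDefinition.{u, v} 𝒟 :=
  fun _ _ M => ∀ D₁ D₂, R D₁ D₂ → fDivergence f (M D₁) (M D₂) ≤ (ε : EReal)

/-! ### The other privacy definitions -/

/-- `(ε, δ)`-approximate DP. -/
def ApproxDP {𝒟 : Type u} [MeasurableSpace 𝒟] (R : 𝒟 → 𝒟 → Prop) (ε δ : ℝ) :
    PrivacyDefinition.{u, v} 𝒟 :=
  fun O _ M => ∀ D₁ D₂, R D₁ D₂ → ∀ S : Set O, MeasurableSet S →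
    (M D₁).real S ≤ Real.exp ε * (M D₂).real S + δ

/-- `ε`-Kullback-Leibler privacy. -/
def KLPrivacy {𝒟 : Type u} [MeasurableSpace 𝒟] (R : 𝒟 → 𝒟 → Prop) (ε : ℝ) :
    PrivacyDefinition.{u, v} 𝒟 :=
  fun _ _ M => ∀ D₁ D₂, R D₁ D₂ → ((klDiv (M D₁) (M D₂) : ℝ≥0∞) : EReal) ≤ (ε : EReal)

/-- The privacy loss `ln (p/q)`, where `p` and `q` are the densities of `P` and `Q` with respect to
`P + Q`: it is `∞` where only `q` vanishes and `-∞` where `p` vanishes. -/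
def privacyLoss {O : Type v} [MeasurableSpace O] (P Q : Measure O) (x : O) : EReal :=
  ENNReal.log (P.rnDeriv (P + Q) x / Q.rnDeriv (P + Q) x)

/-- `(α, ε)`-Rényi DP (for `α > 1`): `E_{O ∼ M(D₁)} [exp ((α - 1) L(O))] ≤ exp ((α - 1) ε)`. -/
def RenyiDP {𝒟 : Type u} [MeasurableSpace 𝒟] (R : 𝒟 → 𝒟 → Prop) (α ε : ℝ) :
    PrivacyDefinition.{u, v} 𝒟 :=
  fun _ _ M => ∀ D₁ D₂, R D₁ D₂ →
    ∫⁻ x, EReal.exp (((α - 1 : ℝ) : EReal) * privacyLoss (M D₁) (M D₂) x) ∂(M D₁)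
      ≤ ENNReal.ofReal (Real.exp ((α - 1) * ε))

/-- `(ξ, ρ)`-zero-concentrated DP. -/
def ZeroConcentratedDP {𝒟 : Type u} [MeasurableSpace 𝒟] (R : 𝒟 → 𝒟 → Prop) (ξ ρ : ℝ) :
    PrivacyDefinition.{u, v} 𝒟 :=
  fun _ _ M => ∀ D₁ D₂, R D₁ D₂ → ∀ α : ℝ, 1 < α →
    ∫⁻ x, EReal.exp (((α - 1 : ℝ) : EReal) * privacyLoss (M D₁) (M D₂) x) ∂(M D₁)
      ≤ ENNReal.ofReal (Real.exp ((α - 1) * (ξ + ρ * α)))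

/-! ### Mutual-information privacy -/

/-- Finite sequences of records. -/
abbrev Dataset (T : Type w) : Type w := Σ n : ℕ, (Fin n → T)

/-- The dataset whose `i`-th record is `p.2` and whose remaining records are `p.1`. -/
def insertRecord {T : Type w} {n : ℕ} (i : Fin (n + 1)) (p : (Fin n → T) × T) : Dataset T :=
  ⟨n + 1, i.insertNth p.2 p.1⟩

theorem measurable_dataset_mk {T : Type w} [MeasurableSpace T] (n : ℕ) :
    Measurable (fun D : Fin n → T => (⟨n, D⟩ : Dataset T)) :=
  fun _ hs => (MeasurableSpace.measurableSet_iInf.1 hs) n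

theorem measurable_insertRecord {T : Type w} [MeasurableSpace T] {n : ℕ} (i : Fin (n + 1)) :
    Measurable (insertRecord i : (Fin n → T) × T → Dataset T) :=
  (measurable_dataset_mk (n + 1)).comp
    ((MeasurableEquiv.piFinSuccAbove (fun _ => T) i).symm.measurable.comp measurable_swap)

/-- The mechanism restricted to datasets of size `n`. -/
def mechOnSize {T : Type w} [MeasurableSpace T] {O : Type v} [MeasurableSpace O]
    (M : Kernel (Dataset T) O) (n : ℕ) : Kernel (Fin n → T) O :=
  M.comap (fun D => (⟨n, D⟩ : Dataset T)) (measurable_dataset_mk n)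

/-- The conditional distribution of the record `D(i)` given `D_{-i}`, for `D ∼ θ`. -/
def recordGivenRest {T : Type w} [MeasurableSpace T] [StandardBorelSpace T] [Nonempty T] {n : ℕ}
    (θ : Measure (Fin (n + 1) → T)) [IsProbabilityMeasure θ] (i : Fin (n + 1)) :
    Kernel (Fin n → T) T :=
  condDistrib (fun D : Fin (n + 1) → T => D i) (fun D => i.removeNth D) θ

/-- The conditional distribution of `M(D)` given `D_{-i}`, for `D ∼ θ`: draw `D(i)` from its
conditional distribution, then run `M`. -/
def outputGivenRest {T : Type w} [MeasurableSpace T] [StandardBorelSpace T] [Nonempty T]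
    {O : Type v} [MeasurableSpace O] (M : Kernel (Dataset T) O) {n : ℕ}
    (θ : Measure (Fin (n + 1) → T)) [IsProbabilityMeasure θ] (i : Fin (n + 1)) :
    Kernel (Fin n → T) O :=
  (M.comap (insertRecord i) (measurable_insertRecord i)) ∘ₖ (Kernel.id ×ₖ recordGivenRest θ i)

/-- The conditional mutual information `I(D(i) ; M(D) | D_{-i})` for `D ∼ θ`: the Kullback-Leibler
divergence of the joint law of `(D_{-i}, D(i), M(D))` from the law with the same conditional
marginals under which `D(i)` and `M(D)` are conditionally independent given `D_{-i}`. -/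
def recordMutualInfo {T : Type w} [MeasurableSpace T] [StandardBorelSpace T] [Nonempty T]
    {O : Type v} [MeasurableSpace O] (M : Kernel (Dataset T) O) {n : ℕ}
    (θ : Measure (Fin (n + 1) → T)) [IsProbabilityMeasure θ] (i : Fin (n + 1)) : ℝ≥0∞ :=
  klDiv
    ((θ ⊗ₘ mechOnSize M (n + 1)).map
      (fun q : (Fin (n + 1) → T) × O => (i.removeNth q.1, q.1 i, q.2)))
    ((θ.map (fun D => i.removeNth D)) ⊗ₘ (recordGivenRest θ i ×ₖ outputGivenRest M θ i))

/-- `ε`-mutual-information privacy: the bound holds for every size, every record and every prior. -/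
def MIPrivacy (T : Type w) [MeasurableSpace T] [StandardBorelSpace T] [Nonempty T] (ε : ℝ) :
    PrivacyDefinition.{w, v} (Dataset T) :=
  fun _ _ M => ∀ (n : ℕ) (θ : Measure (Fin (n + 1) → T)) [IsProbabilityMeasure θ]
    (i : Fin (n + 1)), ((recordMutualInfo M θ i : ℝ≥0∞) : EReal) ≤ (ε : EReal)

end

/-! A convex `f` on the positive half-line is the supremum of its affine minorants `a * t + b`, and
the same minorants recover `f(0+)` as the supremum of the `b` and `f'(∞)` as the supremum of the
`a`. Hence `D_f(P ‖ Q)` is the supremum of `∑ j, (a j * ∫ φ j ∂P + b j * ∫ φ j ∂Q)` over finite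
families of minorants and measurable partitions of unity `φ`; this is `fDivergence_le_iff`. Each
such expression is linear in the pair `(P, Q)`, so a common upper bound survives mixing. Applying a
Markov kernel `g` to both measures replaces `φ j` by `x ↦ ∫ φ j ∂g x`, which is again a partition of
unity, so the bound survives post-processing. Absolute continuity and finiteness of the divergence
play no role.

One half of the criterion integrates a pointwise inequality. The other is monotone convergence along
the running maxima of a countable family of minorants (`ConvexOn.exists_seq_affineMinorant`), each
maximum being cut into measurable pieces (`exists_measurable_argmax`).

Kullback-Leibler divergence is the case `t log t + 1 - t`, the Rényi moment is the case `t ^ α`, and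
zero-concentrated DP is an intersection of Rényi conditions. Conditional mutual information is a
Kullback-Leibler divergence between two laws that are both affine in the mechanism and on which
post-processing acts through one common kernel. Approximate DP is treated directly: a Hahn
decomposition extends its inequality from events to `[0, 1]`-valued tests. -/

/-! ### Affine minorants of a convex function on the positive half-line -/

/-- The affine function `t ↦ a * t + b` lies below `f` on the positive half-line. -/
def IsAffineMinorant (f : ℝ → ℝ) (a b : ℝ) : Prop :=
  ∀ t : ℝ, 0 < t → a * t + b ≤ f t

theorem ConvexOn.exists_supporting_line {f : ℝ → ℝ} (hf : ConvexOn ℝ (Set.Ioi 0) f) {s : ℝ}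
    (hs : 0 < s) : ∃ a : ℝ, ∀ t : ℝ, 0 < t → f s + a * (t - s) ≤ f t := by
  have hint : s ∈ interior (Set.Ioi (0 : ℝ)) := by simpa using hs
  refine ⟨derivWithin f (Set.Ioi s) s, fun t ht => ?_⟩
  rcases lt_trichotomy t s with h | h | h
  · have h1 := hf.slope_le_leftDeriv_of_mem_interior ht hint h
    have h2 := h1.trans (hf.leftDeriv_le_rightDeriv_of_mem_interior hint)
    rw [slope_def_field, div_le_iff₀ (by linarith)] at h2
    linarith
  · simp [h]
  · have h1 := hf.rightDeriv_le_slope_of_mem_interior hint ht h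
    rw [slope_def_field, le_div_iff₀ (by linarith)] at h1
    linarith

theorem IsAffineMinorant.le_fAtZero {f : ℝ → ℝ} {a b : ℝ} (h : IsAffineMinorant f a b) :
    (b : EReal) ≤ fAtZero f := by
  have h1 : Tendsto (fun t : ℝ => ((a * t + b : ℝ) : EReal)) (𝓝[>] 0) (𝓝 (b : EReal)) := by
    refine (continuous_coe_real_ereal.tendsto b).comp ?_
    have : Tendsto (fun t : ℝ => a * t + b) (𝓝 0) (𝓝 (a * 0 + b)) :=
      Continuous.tendsto (by fun_prop) 0
    simpa using this.mono_left nhdsWithin_le_nhds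
  rw [← h1.limsup_eq]
  refine limsup_le_limsup ?_
  filter_upwards [self_mem_nhdsWithin] with t ht
  exact EReal.coe_le_coe_iff.2 (h t ht)

theorem IsAffineMinorant.le_fSlopeAtTop {f : ℝ → ℝ} {a b : ℝ} (h : IsAffineMinorant f a b) :
    (a : EReal) ≤ fSlopeAtTop f := by
  have h1 : Tendsto (fun t : ℝ => ((a + b / t : ℝ) : EReal)) atTop (𝓝 (a : EReal)) := by
    refine (continuous_coe_real_ereal.tendsto a).comp ?_
    simpa using (tendsto_const_nhds (x := b)).div_atTop tendsto_id |>.const_add a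
  rw [← h1.limsup_eq]
  refine limsup_le_limsup ?_
  filter_upwards [eventually_gt_atTop 0] with t ht
  refine EReal.coe_le_coe_iff.2 ?_
  rw [le_div_iff₀ ht, add_mul, div_mul_cancel₀ _ ht.ne']
  exact h t ht

/-- Take the supporting line at a small `t` with `f t` above `c`. Its intercept is `f t - a * t`,
and `a` is at most the slope `a₁` of a supporting line at `1`, so the correction `a * t` has an
upper bound that tends to `0`. -/
theorem ConvexOn.exists_affineMinorant_gt_of_lt_fAtZero {f : ℝ → ℝ}
    (hf : ConvexOn ℝ (Set.Ioi 0) f) {c : ℝ} (hc : (c : EReal) < fAtZero f) :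
    ∃ a b, IsAffineMinorant f a b ∧ c < b := by
  obtain ⟨a₁, ha₁⟩ := hf.exists_supporting_line one_pos
  obtain ⟨c', hcc', hc'⟩ := EReal.lt_iff_exists_real_btwn.1 hc
  have hcc' : c < c' := EReal.coe_lt_coe_iff.1 hcc'
  have h1 : ∃ᶠ t : ℝ in 𝓝[>] 0, (c' : EReal) < f t :=
    frequently_lt_of_lt_limsup (by isBoundedDefault) hc'
  have h2 : ∀ᶠ t : ℝ in 𝓝[>] 0, max a₁ 0 * t < c' - c := by
    have : Tendsto (fun t : ℝ => max a₁ 0 * t) (𝓝 0) (𝓝 (max a₁ 0 * 0)) :=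
      Continuous.tendsto (by fun_prop) 0
    rw [mul_zero] at this
    exact (this.mono_left nhdsWithin_le_nhds).eventually_lt_const (by linarith)
  have h3 : ∀ᶠ t : ℝ in 𝓝[>] 0, t < 1 := nhdsWithin_le_nhds (eventually_lt_nhds one_pos)
  have h4 : ∀ᶠ t : ℝ in 𝓝[>] 0, 0 < t := self_mem_nhdsWithin
  obtain ⟨t, ht, h2, h3, h4⟩ := (h1.and_eventually (h2.and (h3.and h4))).exists
  have ht : c' < f t := EReal.coe_lt_coe_iff.1 ht
  obtain ⟨a, ha⟩ := hf.exists_supporting_line h4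
  refine ⟨a, f t - a * t, fun s hs => by linarith [ha s hs], ?_⟩
  -- Each of the two supporting lines is evaluated at the contact point of the other.
  have h5 : a * (1 - t) ≤ a₁ * (1 - t) := by linarith [ha 1 one_pos, ha₁ t h4]
  have h6 : a ≤ max a₁ 0 := (le_of_mul_le_mul_right h5 (by linarith)).trans (le_max_left _ _)
  have h7 : a * t ≤ max a₁ 0 * t := mul_le_mul_of_nonneg_right h6 h4.le
  linarith

/-- A supporting line at a large `t` stays below `f` at `1`, which forces its slope to be at least
`(f t - f 1) / (t - 1)`. -/
theorem ConvexOn.exists_affineMinorant_gt_of_lt_fSlopeAtTop {f : ℝ → ℝ}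
    (hf : ConvexOn ℝ (Set.Ioi 0) f) {c : ℝ} (hc : (c : EReal) < fSlopeAtTop f) :
    ∃ a b, IsAffineMinorant f a b ∧ c < a := by
  obtain ⟨c', hcc', hc'⟩ := EReal.lt_iff_exists_real_btwn.1 hc
  have hcc' : c < c' := EReal.coe_lt_coe_iff.1 hcc'
  have h1 : ∃ᶠ t : ℝ in atTop, (c' : EReal) < ((f t / t : ℝ) : EReal) :=
    frequently_lt_of_lt_limsup (by isBoundedDefault) hc'
  have h2 : ∀ᶠ t : ℝ in atTop, f 1 - c < (c' - c) * t :=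
    (tendsto_id.const_mul_atTop (sub_pos.2 hcc')).eventually_gt_atTop _
  obtain ⟨t, ht, h2, h3⟩ := (h1.and_eventually (h2.and (eventually_gt_atTop 1))).exists
  have ht : c' < f t / t := EReal.coe_lt_coe_iff.1 ht
  have h4 : 0 < t := by linarith
  rw [lt_div_iff₀ h4] at ht
  obtain ⟨a, ha⟩ := hf.exists_supporting_line h4
  refine ⟨a, f t - a * t, fun s hs => by linarith [ha s hs], ?_⟩
  have h5 := ha 1 one_pos
  refine lt_of_mul_lt_mul_right (a := t - 1) ?_ (by linarith)
  linarith

theorem IsAffineMinorant.le_fAtRatio {f : ℝ → ℝ} {a b : ℝ} (h : IsAffineMinorant f a b) {t : ℝ}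
    (ht : 0 ≤ t) : ((a * t + b : ℝ) : EReal) ≤ fAtRatio f (ENNReal.ofReal t) := by
  rcases ht.eq_or_lt with rfl | ht
  · simpa [fAtRatio] using h.le_fAtZero
  · simpa [fAtRatio, ht.not_ge, ht.le] using EReal.coe_le_coe_iff.2 (h t ht)

theorem ConvexOn.exists_affineMinorant_gt_of_lt_fAtRatio {f : ℝ → ℝ}
    (hf : ConvexOn ℝ (Set.Ioi 0) f) {t : ℝ} (ht : 0 ≤ t) {c : ℝ}
    (hc : (c : EReal) < fAtRatio f (ENNReal.ofReal t)) :
    ∃ a b, IsAffineMinorant f a b ∧ c < a * t + b := by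
  rcases ht.eq_or_lt with rfl | ht
  · simpa using hf.exists_affineMinorant_gt_of_lt_fAtZero (by simpa [fAtRatio] using hc)
  · obtain ⟨a, ha⟩ := hf.exists_supporting_line ht
    refine ⟨a, f t - a * t, fun s hs => by linarith [ha s hs], ?_⟩
    have : c < f t := by simpa [fAtRatio, ht.not_ge, ht.le] using hc
    linarith

/-- A convex function on the positive half-line, its limit at `0` and its slope at infinity are
given by one sequence of affine minorants. -/
theorem ConvexOn.exists_seq_affineMinorant {f : ℝ → ℝ} (hf : ConvexOn ℝ (Set.Ioi 0) f) :
    ∃ a b : ℕ → ℝ, (∀ n, IsAffineMinorant f (a n) (b n)) ∧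
      (∀ t, 0 ≤ t → fAtRatio f (ENNReal.ofReal t) = ⨆ n, ((a n * t + b n : ℝ) : EReal)) ∧
      fSlopeAtTop f = ⨆ n, (a n : EReal) := by
  -- Homogeneous coordinates: `(t, 1)` stands for the point `t` and `(1, 0)` for infinity. The
  -- linear form `a * z.1 + b * z.2` then gives both the value at `t` and the slope, so one
  -- countable subfamily serves for both.
  let X := {z : ℝ × ℝ // 0 ≤ z.1 ∧ z.2 = 1 ∨ z = (1, 0)}
  let F : X → EReal := fun z =>
    if z.1.2 = 0 then fSlopeAtTop f else fAtRatio f (ENNReal.ofReal z.1.1)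
  let lin : ℝ × ℝ → X → EReal := fun c z => ((c.1 * z.1.1 + c.2 * z.1.2 : ℝ) : EReal)
  let 𝓕 : Set (X → EReal) := lin '' {c | IsAffineMinorant f c.1 c.2}
  have hlsc : ∀ g ∈ 𝓕, LowerSemicontinuous g := by
    rintro _ ⟨c, -, rfl⟩
    exact (continuous_coe_real_ereal.comp (by fun_prop)).lowerSemicontinuous
  have hlub : IsLUB 𝓕 F := by
    refine isLUB_pi.2 fun z => ⟨?_, fun u hu => ?_⟩
    · rintro _ ⟨_, ⟨c, hc, rfl⟩, rfl⟩
      obtain ⟨hp, hq⟩ | h := z.2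
      · simpa [F, lin, hq] using IsAffineMinorant.le_fAtRatio hc hp
      · simpa [F, lin, h] using IsAffineMinorant.le_fSlopeAtTop hc
    · refine EReal.ge_of_forall_gt_iff_ge.1 fun c hc => ?_
      have key : ∃ a b, IsAffineMinorant f a b ∧ c < a * z.1.1 + b * z.1.2 := by
        obtain ⟨hp, hq⟩ | h := z.2
        · simpa [hq] using hf.exists_affineMinorant_gt_of_lt_fAtRatio hp (by simpa [F, hq] using hc)
        · simpa [h] using hf.exists_affineMinorant_gt_of_lt_fSlopeAtTop (by simpa [F, h] using hc)
      obtain ⟨a, b, hab, hlt⟩ := key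
      exact (EReal.coe_le_coe_iff.2 hlt.le).trans (hu ⟨_, ⟨(a, b), hab, rfl⟩, rfl⟩)
  obtain ⟨𝓕', hsub, hcount, hlub'⟩ := exists_countable_lowerSemicontinuous_isLUB hlsc hlub
  -- An empty family would have supremum `⊥`, whereas `F` takes the real value `f 1` at `(1, 1)`.
  have hne : 𝓕'.Nonempty := by
    by_contra h
    rw [Set.not_nonempty_iff_eq_empty] at h
    have h1 := (h ▸ hlub' : IsLUB ∅ F).2 (by simp : (⊥ : X → EReal) ∈ upperBounds ∅)
      ⟨(1, 1), Or.inl (by simp)⟩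
    simp [F, fAtRatio, not_le.2 (zero_lt_one' ℝ)] at h1
  obtain ⟨g, hg⟩ := hcount.exists_eq_range hne
  have hmem : ∀ n, ∃ c : ℝ × ℝ, IsAffineMinorant f c.1 c.2 ∧ lin c = g n := fun n =>
    hsub (hg ▸ Set.mem_range_self n)
  choose c hc hcg using hmem
  have hF : ∀ z, F z = ⨆ n, lin (c n) z := fun z => by
    have h1 := (isLUB_pi.1 hlub') z
    rw [hg, ← Set.range_comp] at h1
    simpa [hcg] using h1.iSup_eq.symm
  refine ⟨fun n => (c n).1, fun n => (c n).2, hc, fun t ht => ?_, ?_⟩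
  · simpa [F, lin] using hF ⟨(t, 1), Or.inl ⟨ht, rfl⟩⟩
  · simpa [F, lin] using hF ⟨(1, 0), Or.inr rfl⟩

/-! ### Integrals of extended-real functions with an integrable minorant -/

/-- The integral of the positive part minus the integral of the negative part. -/
noncomputable def erealIntegral {O : Type v} [MeasurableSpace O] (μ : Measure O) (F : O → EReal) : EReal :=
  ((∫⁻ x, (F x).toENNReal ∂μ : ℝ≥0∞) : EReal) - ((∫⁻ x, (-F x).toENNReal ∂μ : ℝ≥0∞) : EReal)

/-- This is `x = (x - g) + g` split into positive and negative parts and rearranged without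
subtraction, so that it can be integrated in `ℝ≥0∞` even where `x = ⊤`. -/
theorem toENNReal_add_ofReal_neg_eq {x : EReal} {g : ℝ} (h : (g : EReal) ≤ x) :
    x.toENNReal + ENNReal.ofReal (-g) =
      (x - g).toENNReal + ENNReal.ofReal g + (-x).toENNReal := by
  induction x with
  | bot => simp at h
  | top => simp
  | coe x =>
    have h : g ≤ x := EReal.coe_le_coe_iff.1 h
    rw [← EReal.coe_sub, ← EReal.coe_neg]
    simp only [EReal.toENNReal_of_ne_top (EReal.coe_ne_top _), EReal.toReal_coe]
    rw [← ENNReal.toReal_eq_toReal_iff' (by finiteness) (by finiteness),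
      ENNReal.toReal_add (by finiteness) (by finiteness),
      ENNReal.toReal_add (by finiteness) (by finiteness),
      ENNReal.toReal_add (by finiteness) (by finiteness)]
    simp only [ENNReal.toReal_ofReal']
    rcases le_total 0 x with hx | hx <;> rcases le_total 0 g with hg | hg <;>
      simp [hx, hg, h] <;> linarith

/-- Subtracting an integrable minorant leaves a nonnegative function, to which monotone convergence
applies. -/
theorem erealIntegral_eq_lintegral_add {O : Type v} [MeasurableSpace O] {μ : Measure O}
    {F : O → EReal} (hF : AEMeasurable F μ) {g : O → ℝ} (hg : Integrable g μ)
    (hgF : ∀ᵐ x ∂μ, (g x : EReal) ≤ F x) :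
    erealIntegral μ F =
      ((∫⁻ x, (F x - g x).toENNReal ∂μ : ℝ≥0∞) : EReal) + ((∫ x, g x ∂μ : ℝ) : EReal) := by
  have hgm := hg.aemeasurable
  have hB : ∫⁻ x, ENNReal.ofReal (-g x) ∂μ ≠ ∞ := hg.neg.lintegral_lt_top.ne
  have hD : ∫⁻ x, ENNReal.ofReal (g x) ∂μ ≠ ∞ := hg.lintegral_lt_top.ne
  have hE : ∫⁻ x, (-F x).toENNReal ∂μ ≠ ∞ := by
    refine ne_top_of_le_ne_top hB (lintegral_mono_ae ?_)
    filter_upwards [hgF] with x hx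
    have h1 := EReal.toENNReal_le_toENNReal (EReal.neg_le_neg_iff.2 hx)
    rwa [← EReal.coe_neg, EReal.toENNReal_of_ne_top (EReal.coe_ne_top _), EReal.toReal_coe] at h1
  have hsum : ∫⁻ x, (F x).toENNReal ∂μ + ∫⁻ x, ENNReal.ofReal (-g x) ∂μ =
      ∫⁻ x, (F x - g x).toENNReal ∂μ + ∫⁻ x, ENNReal.ofReal (g x) ∂μ
        + ∫⁻ x, (-F x).toENNReal ∂μ := by
    have hFm' : AEMeasurable (fun x => (-F x).toENNReal) μ := hF.neg.ereal_toENNReal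
    have hgm' : AEMeasurable (fun x => ENNReal.ofReal (-g x)) μ := hgm.neg.ennreal_ofReal
    rw [← lintegral_add_right' _ hgm', ← lintegral_add_right' _ hgm.ennreal_ofReal,
      ← lintegral_add_right' _ hFm']
    refine lintegral_congr_ae ?_
    filter_upwards [hgF] with x hx using toENNReal_add_ofReal_neg_eq hx
  rw [integral_eq_lintegral_pos_part_sub_lintegral_neg_part hg, erealIntegral]
  revert hsum hB hD hE
  generalize ∫⁻ x, ENNReal.ofReal (-g x) ∂μ = B
  generalize ∫⁻ x, ENNReal.ofReal (g x) ∂μ = D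
  generalize ∫⁻ x, (-F x).toENNReal ∂μ = E
  generalize ∫⁻ x, (F x).toENNReal ∂μ = A
  generalize ∫⁻ x, (F x - g x).toENNReal ∂μ = C
  intro hB hD hE hsum
  lift B to NNReal using hB
  lift D to NNReal using hD
  lift E to NNReal using hE
  -- Since `B`, `D` and `E` are finite, `A` and `C` are infinite together; otherwise the claim is
  -- real arithmetic.
  induction A with
  | top =>
    have hC : C = ∞ := by
      by_contra hC
      lift C to NNReal using hC
      exact absurd hsum.symm (by simp)
    subst hC
    simp [← EReal.coe_nnreal_eq_coe_real, sub_eq_add_neg]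
  | coe A =>
    have hC : C ≠ ∞ := by
      rintro rfl
      exact absurd hsum (by simp)
    lift C to NNReal using hC
    have h1 : (A : ℝ) + B = C + D + E := by exact_mod_cast hsum
    have h2 : (A : ℝ) - E = C + (D - B) := by linarith
    simp only [ENNReal.coe_toReal, EReal.coe_nnreal_eq_coe_real]
    rw [← EReal.coe_sub, h2, EReal.coe_add]

theorem integral_le_erealIntegral {O : Type v} [MeasurableSpace O] {μ : Measure O}
    {F : O → EReal} (hF : AEMeasurable F μ) {g : O → ℝ} (hg : Integrable g μ)
    (hgF : ∀ᵐ x ∂μ, (g x : EReal) ≤ F x) :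
    ((∫ x, g x ∂μ : ℝ) : EReal) ≤ erealIntegral μ F := by
  rw [erealIntegral_eq_lintegral_add hF hg hgF]
  exact le_add_of_nonneg_left (EReal.coe_ennreal_nonneg _)

/-- Monotone convergence for the nonnegative functions `H n - H 0`. -/
theorem erealIntegral_iSup_le {O : Type v} [MeasurableSpace O] {μ : Measure O}
    {F : O → EReal} {H : ℕ → O → ℝ} (hH : ∀ n, Integrable (H n) μ)
    (hmono : ∀ x, Monotone fun n => H n x) (hF : ∀ᵐ x ∂μ, F x = ⨆ n, (H n x : EReal))
    {ε : ℝ} (hε : ∀ n, ∫ x, H n x ∂μ ≤ ε) : erealIntegral μ F ≤ (ε : EReal) := by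
  have hFm : AEMeasurable F μ :=
    (AEMeasurable.iSup fun n => (hH n).aemeasurable.coe_real_ereal).congr
      (hF.mono fun x hx => hx.symm)
  have h0 : ∀ᵐ x ∂μ, (H 0 x : EReal) ≤ F x := by
    filter_upwards [hF] with x hx
    rw [hx]
    exact le_iSup (fun n => (H n x : EReal)) 0
  rw [erealIntegral_eq_lintegral_add hFm (hH 0) h0]
  have hd : ∀ n, Integrable (fun x => H n x - H 0 x) μ := fun n => (hH n).sub (hH 0)
  have h1 : ∫⁻ x, (F x - H 0 x).toENNReal ∂μ = ⨆ n, ∫⁻ x, ENNReal.ofReal (H n x - H 0 x) ∂μ := by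
    rw [← lintegral_iSup' (fun n => (hd n).aemeasurable.ennreal_ofReal)
      (ae_of_all _ fun x m n hmn => ENNReal.ofReal_le_ofReal (by linarith [hmono x hmn]))]
    refine lintegral_congr_ae ?_
    filter_upwards [hF] with x hx
    -- Subtracting the finite value `H 0 x` is continuous in `EReal`, also at `F x = ⊤`.
    have h2 : Tendsto (fun n => (H n x : EReal) - H 0 x) atTop (𝓝 (F x - H 0 x)) := by
      rw [hx]
      simp only [sub_eq_add_neg, ← EReal.coe_neg]
      refine (EReal.continuousAt_add (Or.inr (EReal.coe_ne_bot _))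
        (Or.inr (EReal.coe_ne_top _))).tendsto.comp
        ((tendsto_atTop_iSup fun m n hmn => EReal.coe_le_coe_iff.2 (hmono x hmn)).prodMk_nhds
          tendsto_const_nhds)
    have h3 := (EReal.continuous_toENNReal.tendsto _).comp h2
    refine tendsto_nhds_unique h3 ?_
    have h4 : (fun n => ENNReal.ofReal (H n x - H 0 x)) =
        EReal.toENNReal ∘ fun n => (H n x : EReal) - H 0 x := by
      funext n
      simp [← EReal.coe_sub, EReal.toENNReal_of_ne_top]
    rw [← h4]
    exact tendsto_atTop_iSup fun m n hmn => ENNReal.ofReal_le_ofReal (by linarith [hmono x hmn])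
  have h2 : ∫⁻ x, (F x - H 0 x).toENNReal ∂μ ≤ ENNReal.ofReal (ε - ∫ x, H 0 x ∂μ) := by
    rw [h1]
    refine iSup_le fun n => ?_
    rw [← ofReal_integral_eq_lintegral_ofReal (hd n)
      (ae_of_all _ fun x => sub_nonneg.2 (hmono x (Nat.zero_le n)))]
    refine ENNReal.ofReal_le_ofReal ?_
    rw [integral_sub (hH n) (hH 0)]
    linarith [hε n]
  calc _ ≤ ((ENNReal.ofReal (ε - ∫ x, H 0 x ∂μ) : ℝ≥0∞) : EReal)
          + ((∫ x, H 0 x ∂μ : ℝ) : EReal) := by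
        gcongr
        exact_mod_cast h2
    _ = (ε : EReal) := by
        rw [EReal.coe_ennreal_ofReal, max_eq_left (by linarith [hε 0]), ← EReal.coe_add]
        simp

/-- The level sets of `J` cut the space into measurable pieces on each of which the maximum of `g 0,
…, g k` is a single `g i`. -/
theorem exists_measurable_argmax {O : Type v} [MeasurableSpace O] {g : ℕ → O → ℝ}
    (hg : ∀ n, Measurable (g n)) (k : ℕ) :
    ∃ J : O → ℕ, Measurable J ∧ (∀ x, J x ≤ k) ∧ ∀ x, ∀ i ≤ k, g i x ≤ g (J x) x := by
  induction k with
  | zero => exact ⟨fun _ => 0, measurable_const, fun _ => le_rfl, by simp⟩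
  | succ k ih =>
    obtain ⟨J, hJ, hle, hmax⟩ := ih
    -- Joint measurability in the index is free because `ℕ` is countable.
    have hgJ : Measurable fun x => g (J x) x :=
      (measurable_from_prod_countable_right (f := fun z : ℕ × O => g z.1 z.2) hg).comp
        (hJ.prodMk measurable_id)
    classical
    refine ⟨fun x => if g (J x) x < g (k + 1) x then k + 1 else J x,
      Measurable.ite (measurableSet_lt hgJ (hg _)) measurable_const hJ, fun x => ?_,
      fun x i hi => ?_⟩
    · have := hle x
      dsimp only
      split_ifs <;> omega
    · rcases Nat.lt_succ_iff_lt_or_eq.1 (Nat.lt_succ_of_le hi) with h | rfl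
      · have := hmax x i (Nat.lt_succ_iff.1 h)
        dsimp only
        split_ifs with h' <;> linarith
      · dsimp only
        split_ifs with h'
        · exact le_rfl
        · exact not_lt.1 h'

/-! ### The variational description of `f`-divergences -/

/-- Every finite family of affine minorants of `f`, weighted by a measurable partition of unity,
has total integral at most `ε` against `P` and `Q`. -/
def AffineTestBound {O : Type v} [MeasurableSpace O] (f : ℝ → ℝ) (P Q : Measure O) (ε : ℝ) : Prop :=
  ∀ (k : ℕ) (a b : Fin k → ℝ) (φ : Fin k → O → ℝ), (∀ j, IsAffineMinorant f (a j) (b j)) →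
    (∀ j, Measurable (φ j)) → (∀ j x, 0 ≤ φ j x) → (∀ x, ∑ j, φ j x = 1) →
    ∑ j, (a j * ∫ x, φ j x ∂P + b j * ∫ x, φ j x ∂Q) ≤ ε

theorem integrable_of_mem_Icc {O : Type v} [MeasurableSpace O] {μ : Measure O} [IsFiniteMeasure μ]
    {φ : O → ℝ} (hφ : Measurable φ) (h0 : ∀ x, 0 ≤ φ x) (h1 : ∀ x, φ x ≤ 1) : Integrable φ μ :=
  Integrable.of_bound hφ.aestronglyMeasurable 1
    (ae_of_all _ fun x => by rw [Real.norm_of_nonneg (h0 x)]; exact h1 x)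

/-- The density of `P` with respect to `Q + P.singularPart Q`, where `N` is a `Q`-null set that
carries the singular part. -/
noncomputable def lebesgueDensity {O : Type v} [MeasurableSpace O] (P Q : Measure O) (N : Set O) :
    O → ℝ :=
  open Classical in fun x => if x ∈ N then 1 else (P.rnDeriv Q x).toReal

theorem measurable_lebesgueDensity {O : Type v} [MeasurableSpace O] (P Q : Measure O) {N : Set O}
    (hN : MeasurableSet N) : Measurable (lebesgueDensity P Q N) := by
  classical
  exact Measurable.ite hN measurable_const (P.measurable_rnDeriv Q).ennreal_toReal

section Decomposition

variable {O : Type v} [MeasurableSpace O] {P Q : Measure O} {N : Set O}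

theorem lebesgueDensity_ae_eq_left (hQ : Q N = 0) :
    lebesgueDensity P Q N =ᵐ[Q] fun x => (P.rnDeriv Q x).toReal := by
  filter_upwards [measure_eq_zero_iff_ae_notMem.1 hQ] with x hx
  simp [lebesgueDensity, hx]

theorem lebesgueDensity_ae_eq_right (hP : P.singularPart Q Nᶜ = 0) :
    lebesgueDensity P Q N =ᵐ[P.singularPart Q] fun _ => 1 := by
  filter_upwards [measure_eq_zero_iff_ae_notMem.1 hP] with x hx
  simp [lebesgueDensity, not_not.1 hx]

theorem integrable_lebesgueDensity [IsFiniteMeasure P] [IsFiniteMeasure Q] (hQ : Q N = 0)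
    (hP : P.singularPart Q Nᶜ = 0) :
    Integrable (lebesgueDensity P Q N) (Q + P.singularPart Q) := by
  refine Integrable.add_measure ?_ ?_
  · exact Measure.integrable_toReal_rnDeriv.congr (lebesgueDensity_ae_eq_left hQ).symm
  · exact (integrable_const 1).congr (lebesgueDensity_ae_eq_right hP).symm

/-- On `Nᶜ` the density produces the absolutely continuous part of `P`; on `N` it is `1` and
produces the singular part. The companion density of `Q` is the indicator of `Nᶜ`. -/
theorem integral_mul_lebesgueDensity [IsFiniteMeasure P] [IsFiniteMeasure Q] (hQ : Q N = 0)
    (hP : P.singularPart Q Nᶜ = 0) {φ : O → ℝ} (hφ : Measurable φ) (h0 : ∀ x, 0 ≤ φ x)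
    (h1 : ∀ x, φ x ≤ 1) :
    ∫ x, φ x * lebesgueDensity P Q N x ∂(Q + P.singularPart Q) = ∫ x, φ x ∂P := by
  have hint := (integrable_lebesgueDensity hQ hP).bdd_mul (c := 1) hφ.aestronglyMeasurable
    (ae_of_all _ fun x => by rw [Real.norm_of_nonneg (h0 x)]; exact h1 x)
  have hφi {μ : Measure O} [IsFiniteMeasure μ] : Integrable φ μ := integrable_of_mem_Icc hφ h0 h1
  have hwd : IsFiniteMeasure (Q.withDensity (P.rnDeriv Q)) := inferInstance
  rw [integral_add_measure hint.left_of_add_measure hint.right_of_add_measure]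
  conv_rhs => rw [P.haveLebesgueDecomposition_add Q, integral_add_measure hφi hφi,
    integral_withDensity_eq_integral_toReal_smul (P.measurable_rnDeriv Q)
      (P.rnDeriv_lt_top Q), add_comm]
  congr 1
  · refine integral_congr_ae ?_
    filter_upwards [lebesgueDensity_ae_eq_left hQ] with x hx
    rw [hx, smul_eq_mul, mul_comm]
  · refine integral_congr_ae ?_
    filter_upwards [lebesgueDensity_ae_eq_right hP] with x hx
    rw [hx, mul_one]

theorem integral_mul_indicator_compl [IsFiniteMeasure P] [IsFiniteMeasure Q] (hN : MeasurableSet N)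
    (hQ : Q N = 0) (hP : P.singularPart Q Nᶜ = 0) {φ : O → ℝ} (hφ : Measurable φ)
    (h0 : ∀ x, 0 ≤ φ x) (h1 : ∀ x, φ x ≤ 1) :
    ∫ x, φ x * Nᶜ.indicator 1 x ∂(Q + P.singularPart Q) = ∫ x, φ x ∂Q := by
  have hint {μ : Measure O} [IsFiniteMeasure μ] : Integrable (fun x => φ x * Nᶜ.indicator 1 x) μ :=
    (Integrable.indicator (integrable_const (1 : ℝ)) hN.compl).bdd_mul (c := 1)
      hφ.aestronglyMeasurable
      (ae_of_all _ fun x => by rw [Real.norm_of_nonneg (h0 x)]; exact h1 x)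
  rw [integral_add_measure hint hint]
  have h2 : ∫ x, φ x * Nᶜ.indicator 1 x ∂P.singularPart Q = 0 := by
    refine integral_eq_zero_of_ae ?_
    filter_upwards [measure_eq_zero_iff_ae_notMem.1 hP] with x hx
    simp [not_not.1 hx]
  rw [h2, add_zero]
  refine integral_congr_ae ?_
  filter_upwards [measure_eq_zero_iff_ae_notMem.1 hQ] with x hx
  simp [hx]

open Classical in
-- The term `f'(∞) · P_s` is the integral of a constant over `N`, so the divergence becomes a single
-- integral. No `∞ - ∞` arises: an affine minorant makes the negative part `Q`-integrable and keeps
-- `f'(∞)` away from `⊥`.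
theorem fDivergence_eq_erealIntegral {f : ℝ → ℝ} [IsFiniteMeasure P] [IsFiniteMeasure Q]
    (hf : ConvexOn ℝ (Set.Ioi 0) f) (hQ : Q N = 0) (hP : P.singularPart Q Nᶜ = 0) :
    fDivergence f P Q = erealIntegral (Q + P.singularPart Q)
      (fun x => if x ∈ N then fSlopeAtTop f else fAtRatio f (P.rnDeriv Q x)) := by
  obtain ⟨a, b, hab, hratio, hslope⟩ := hf.exists_seq_affineMinorant
  have hbot : fSlopeAtTop f ≠ ⊥ := fun h =>
    absurd (h ▸ (hab 0).le_fSlopeAtTop) (by simp)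
  have hQae := measure_eq_zero_iff_ae_notMem.1 hQ
  have hPae := measure_eq_zero_iff_ae_notMem.1 hP
  have hneg : ∫⁻ x, (-fAtRatio f (P.rnDeriv Q x)).toENNReal ∂Q ≠ ∞ := by
    have hi : Integrable (fun x => -(a 0 * (P.rnDeriv Q x).toReal + b 0)) Q :=
      ((Measure.integrable_toReal_rnDeriv.const_mul _).add (integrable_const _)).neg
    refine ne_top_of_le_ne_top hi.lintegral_lt_top.ne (lintegral_mono_ae ?_)
    filter_upwards [P.rnDeriv_lt_top Q] with x hx
    have h1 := (hab 0).le_fAtRatio (ENNReal.toReal_nonneg (a := P.rnDeriv Q x))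
    rw [ENNReal.ofReal_toReal hx.ne] at h1
    have h1 := EReal.toENNReal_le_toENNReal (EReal.neg_le_neg_iff.2 h1)
    rwa [← EReal.coe_neg, EReal.toENNReal_of_ne_top (EReal.coe_ne_top _), EReal.toReal_coe] at h1
  have hsplit (G : EReal → ℝ≥0∞) :
      ∫⁻ x, G (if x ∈ N then fSlopeAtTop f else fAtRatio f (P.rnDeriv Q x))
          ∂(Q + P.singularPart Q) =
        ∫⁻ x, G (fAtRatio f (P.rnDeriv Q x)) ∂Q
          + G (fSlopeAtTop f) * P.singularPart Q Set.univ := by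
    rw [lintegral_add_measure]
    congr 1
    · refine lintegral_congr_ae ?_
      filter_upwards [hQae] with x hx
      simp [hx]
    · rw [← lintegral_const]
      refine lintegral_congr_ae ?_
      filter_upwards [hPae] with x hx
      simp [not_not.1 hx]
  rw [erealIntegral, hsplit EReal.toENNReal, hsplit (fun y => (-y).toENNReal), fDivergence]
  have hs : P.singularPart Q Set.univ ≠ ∞ := measure_ne_top _ _
  revert hneg hs
  generalize ∫⁻ x, (-fAtRatio f (P.rnDeriv Q x)).toENNReal ∂Q = B
  generalize ∫⁻ x, (fAtRatio f (P.rnDeriv Q x)).toENNReal ∂Q = A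
  generalize P.singularPart Q Set.univ = s
  generalize fSlopeAtTop f = c at hbot
  intro hB hs
  lift B to NNReal using hB
  lift s to NNReal using hs
  induction c with
  | bot => exact absurd rfl hbot
  | top =>
    -- The convention `∞ · 0 = 0` decides the case without singular part.
    rcases eq_or_ne s 0 with rfl | hs
    · simp
    · have h1 : (⊤ : EReal) * ((s : ℝ≥0∞) : EReal) = ⊤ :=
        EReal.top_mul_of_pos (by simpa using pos_iff_ne_zero.2 hs)
      have h2 : (⊤ : ℝ≥0∞) * s = ⊤ := ENNReal.top_mul (by simpa using hs)
      have h3 : ((A : EReal) - ((B : ℝ≥0∞) : EReal)) ≠ ⊥ := by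
        rw [EReal.coe_nnreal_eq_coe_real, sub_eq_add_neg, ← EReal.coe_neg]
        simp [EReal.add_eq_bot_iff]
      simp only [EReal.toENNReal_top, EReal.neg_top, EReal.toENNReal_bot, zero_mul, add_zero, h1,
        h2, EReal.add_top_of_ne_bot h3]
      simp [EReal.coe_nnreal_eq_coe_real]
  | coe c =>
    simp only [← EReal.coe_neg, EReal.toENNReal_of_ne_top (EReal.coe_ne_top _), EReal.toReal_coe]
    induction A with
    | top =>
      simp only [ENNReal.ofReal, ← ENNReal.coe_mul, ← ENNReal.coe_add, top_add,
        EReal.coe_nnreal_eq_coe_real, ← EReal.coe_mul, EReal.coe_ennreal_top, EReal.top_sub_coe,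
        EReal.top_add_coe]
    | coe A =>
      simp only [ENNReal.ofReal, ← ENNReal.coe_mul, ← ENNReal.coe_add,
        EReal.coe_nnreal_eq_coe_real, ← EReal.coe_mul, ← EReal.coe_sub, ← EReal.coe_add]
      congr 1
      push_cast
      simp only [Real.coe_toNNReal']
      rcases le_total 0 c with hc | hc <;> simp [hc] <;> ring

end Decomposition

theorem sum_mul_le_of_forall_le {k : ℕ} {w u : Fin k → ℝ} {y : EReal} (hw : ∀ j, 0 ≤ w j)
    (hsum : ∑ j, w j = 1) (hu : ∀ j, (u j : EReal) ≤ y) :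
    ((∑ j, w j * u j : ℝ) : EReal) ≤ y := by
  induction y with
  | top => exact le_top
  | bot =>
    have h : k ≠ 0 := by rintro rfl; simp at hsum
    exact absurd (hu ⟨0, Nat.pos_of_ne_zero h⟩) (by simp)
  | coe y =>
    refine EReal.coe_le_coe_iff.2 ?_
    calc ∑ j, w j * u j ≤ ∑ j, w j * y :=
          Finset.sum_le_sum fun j _ =>
            mul_le_mul_of_nonneg_left (EReal.coe_le_coe_iff.1 (hu j)) (hw j)
      _ = y := by rw [← Finset.sum_mul, hsum, one_mul]

/-- An `f`-divergence is the supremum of the integrals of affine minorants over measurable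
partitions of unity. -/
theorem fDivergence_le_iff {O : Type v} [MeasurableSpace O] {P Q : Measure O} [IsFiniteMeasure P]
    [IsFiniteMeasure Q] {f : ℝ → ℝ} (hf : ConvexOn ℝ (Set.Ioi 0) f) {ε : ℝ} :
    fDivergence f P Q ≤ (ε : EReal) ↔ AffineTestBound f P Q ε := by
  classical
  obtain ⟨N, hN, hQ, hP⟩ := (P.mutuallySingular_singularPart Q).symm
  obtain ⟨a', b', hab', hratio, hslope⟩ := hf.exists_seq_affineMinorant
  rw [fDivergence_eq_erealIntegral hf hQ hP]
  set μ := Q + P.singularPart Q with hμ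
  set F : O → EReal := fun x => if x ∈ N then fSlopeAtTop f else fAtRatio f (P.rnDeriv Q x) with hF
  -- The density of the signed combination `a • P + b • Q` with respect to `μ`.
  let g : ℝ → ℝ → O → ℝ := fun a b x => a * lebesgueDensity P Q N x + b * Nᶜ.indicator 1 x
  have hgm (a b : ℝ) : Measurable (g a b) :=
    ((measurable_lebesgueDensity P Q hN).const_mul a).add
      ((measurable_one.indicator hN.compl).const_mul b)
  have hgi (a b : ℝ) : Integrable (g a b) μ :=
    ((integrable_lebesgueDensity hQ hP).const_mul a).add
      (((integrable_const (1 : ℝ)).indicator hN.compl).const_mul b)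
  have hφg {φ : O → ℝ} (hφ : Measurable φ) (h0 : ∀ x, 0 ≤ φ x) (h1 : ∀ x, φ x ≤ 1) (a b : ℝ) :
      Integrable (fun x => φ x * g a b x) μ :=
    (hgi a b).bdd_mul (c := 1) hφ.aestronglyMeasurable
      (ae_of_all _ fun x => by rw [Real.norm_of_nonneg (h0 x)]; exact h1 x)
  have hφint {φ : O → ℝ} (hφ : Measurable φ) (h0 : ∀ x, 0 ≤ φ x) (h1 : ∀ x, φ x ≤ 1) (a b : ℝ) :
      ∫ x, φ x * g a b x ∂μ = a * ∫ x, φ x ∂P + b * ∫ x, φ x ∂Q := by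
    rw [← integral_mul_lebesgueDensity hQ hP hφ h0 h1,
      ← integral_mul_indicator_compl hN hQ hP hφ h0 h1, ← integral_const_mul, ← integral_const_mul,
      ← integral_add]
    · refine integral_congr_ae (ae_of_all _ fun x => ?_)
      simp only [g]
      ring
    · simpa only [g, one_mul, zero_mul, add_zero] using (hφg hφ h0 h1 1 0).const_mul a
    · simpa only [g, one_mul, zero_mul, zero_add] using (hφg hφ h0 h1 0 1).const_mul b
  have hfin : ∀ᵐ x ∂μ, x ∈ N ∨ P.rnDeriv Q x ≠ ∞ := by
    rw [hμ, ae_add_measure_iff]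
    constructor
    · filter_upwards [P.rnDeriv_lt_top Q] with x hx using Or.inr hx.ne
    · filter_upwards [measure_eq_zero_iff_ae_notMem.1 hP] with x hx using Or.inl (not_not.1 hx)
  have hsup : ∀ᵐ x ∂μ, F x = ⨆ n, (g (a' n) (b' n) x : EReal) := by
    filter_upwards [hfin] with x hx
    by_cases hxN : x ∈ N
    · simp [hF, g, lebesgueDensity, hxN, hslope]
    · have h1 := hratio _ (ENNReal.toReal_nonneg (a := P.rnDeriv Q x))
      rw [ENNReal.ofReal_toReal (hx.resolve_left hxN)] at h1
      simp [hF, g, lebesgueDensity, hxN, h1]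
  have hminor : ∀ᵐ x ∂μ, ∀ a b, IsAffineMinorant f a b → (g a b x : EReal) ≤ F x := by
    filter_upwards [hfin] with x hx a b hab
    by_cases hxN : x ∈ N
    · simpa [hF, g, lebesgueDensity, hxN] using hab.le_fSlopeAtTop
    · have h1 := hab.le_fAtRatio (ENNReal.toReal_nonneg (a := P.rnDeriv Q x))
      rw [ENNReal.ofReal_toReal (hx.resolve_left hxN)] at h1
      simpa [hF, g, lebesgueDensity, hxN] using h1
  have hFm : AEMeasurable F μ :=
    (AEMeasurable.iSup fun n => (hgm (a' n) (b' n)).coe_real_ereal.aemeasurable).congr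
      (hsup.mono fun x hx => hx.symm)
  constructor
  -- At each point a convex combination of minorants is still below `F`.
  · intro h k a b φ hab hφ h0 hsum
    have h1 (j : Fin k) (x : O) : φ j x ≤ 1 :=
      (Finset.single_le_sum (fun i _ => h0 i x) (Finset.mem_univ j)).trans_eq (hsum x)
    have h2 := integral_le_erealIntegral hFm
      (integrable_finsetSum Finset.univ fun j _ => hφg (hφ j) (h0 j) (h1 j) (a j) (b j))
      (hminor.mono fun x hx =>
        sum_mul_le_of_forall_le (fun j => h0 j x) (hsum x) fun j => hx _ _ (hab j))
    rw [integral_finsetSum _ fun j _ => hφg (hφ j) (h0 j) (h1 j) (a j) (b j)] at h2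
    simp_rw [fun j => hφint (hφ j) (h0 j) (h1 j) (a j) (b j)] at h2
    exact EReal.coe_le_coe_iff.1 (h2.trans h)
  · intro h
    choose J hJ hJle hJmax using exists_measurable_argmax fun n => hgm (a' n) (b' n)
    -- Indicators of the level sets of `J k` form a partition of unity, which turns the maximum of
    -- the first `k + 1` minorants into an admissible test.
    let φ : (k : ℕ) → Fin (k + 1) → O → ℝ := fun k j => (J k ⁻¹' {(j : ℕ)}).indicator 1
    have hφ (k j) : Measurable (φ k j) := measurable_one.indicator (hJ k (measurableSet_singleton _))
    have h0 (k j x) : 0 ≤ φ k j x := Set.indicator_nonneg (fun _ _ => zero_le_one) x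
    have h1 (k j x) : φ k j x ≤ 1 := Set.indicator_le_self' (fun _ _ => zero_le_one) x
    have hpick (k x) (u : ℕ → ℝ) : ∑ j, φ k j x * u j = u (J k x) := by
      rw [Finset.sum_eq_single (⟨J k x, Nat.lt_succ_of_le (hJle k x)⟩ : Fin (k + 1))]
      · simp [φ]
      · intro j _ hj
        have : J k x ≠ j := fun h => hj (Fin.ext h.symm)
        simp [φ, this]
      · simp
    have hH (k) : (fun x => g (a' (J k x)) (b' (J k x)) x) =
        fun x => ∑ j, φ k j x * g (a' j) (b' j) x :=
      funext fun x => (hpick k x fun n => g (a' n) (b' n) x).symm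
    refine erealIntegral_iSup_le (H := fun k x => g (a' (J k x)) (b' (J k x)) x) (fun k => ?_)
      (fun x k l hkl => hJmax l x _ ((hJle k x).trans hkl)) ?_ fun k => ?_
    · rw [hH]
      exact integrable_finsetSum _ fun j _ => hφg (hφ k j) (h0 k j) (h1 k j) _ _
    · filter_upwards [hsup] with x hx
      rw [hx]
      refine le_antisymm (iSup_le fun n => le_iSup_of_le n ?_)
        (iSup_le fun k => le_iSup (fun n => (g (a' n) (b' n) x : EReal)) (J k x))
      exact EReal.coe_le_coe_iff.2 (hJmax n x n le_rfl)
    · rw [hH, integral_finsetSum _ fun j _ => hφg (hφ k j) (h0 k j) (h1 k j) _ _]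
      simp_rw [fun j => hφint (hφ k j) (h0 k j) (h1 k j) (a' j) (b' j)]
      exact h (k + 1) _ _ (φ k) (fun j => hab' j) (hφ k) (h0 k) fun x => by
        simpa using hpick k x fun _ => 1

/-! ### Stability of divergence bounds under Markov kernels and mixtures. -/

theorem integral_bind_kernel {O : Type v} {O' : Type w} [MeasurableSpace O] [MeasurableSpace O']
    {P : Measure O} {g : Kernel O O'} {φ : O' → ℝ} (hφ : Integrable φ (P.bind g)) :
    ∫ y, φ y ∂(P.bind g) = ∫ x, ∫ y, φ y ∂g x ∂P := by
  have h : P.bind g = (g ∘ₖ Kernel.const Unit P) () := by rw [Kernel.comp_apply, Kernel.const_apply]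
  rw [h] at hφ ⊢
  rw [Kernel.integral_comp hφ, Kernel.const_apply]

/-- A test on the output pulls back along `g`: the functions `x ↦ ∫ φ j ∂g x` still sum to `1`
because `g` is Markov. -/
theorem AffineTestBound.bind {O : Type v} {O' : Type w} [MeasurableSpace O] [MeasurableSpace O']
    {f : ℝ → ℝ} {P Q : Measure O} [IsFiniteMeasure P] [IsFiniteMeasure Q] {ε : ℝ}
    (h : AffineTestBound f P Q ε) (g : Kernel O O') [IsMarkovKernel g] :
    AffineTestBound f (P.bind g) (Q.bind g) ε := by
  intro k a b φ hab hφ h0 hsum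
  have hi {μ : Measure O'} [IsFiniteMeasure μ] (j : Fin k) : Integrable (φ j) μ :=
    integrable_of_mem_Icc (hφ j) (h0 j) fun x =>
      (Finset.single_le_sum (fun i _ => h0 i x) (Finset.mem_univ j)).trans_eq (hsum x)
  have h2 := h k a b (fun j x => ∫ y, φ j y ∂g x) hab
    (fun j => (hφ j).stronglyMeasurable.integral_kernel.measurable)
    (fun j x => integral_nonneg (h0 j)) fun x => by
      rw [← integral_finsetSum _ fun j _ => hi j]
      simp [hsum]
  simpa only [integral_bind_kernel (hi _)] using h2

/-- The law that is `P₁` with probability `p` and `P₂` with probability `1 - p`. -/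
noncomputable def mixMeasure {O : Type v} [MeasurableSpace O] (p : unitInterval)
    (P₁ P₂ : Measure O) : Measure O :=
  ENNReal.ofReal (p : ℝ) • P₁ + ENNReal.ofReal (1 - (p : ℝ)) • P₂

theorem mixKernel_apply {𝒟 : Type u} [MeasurableSpace 𝒟] {O : Type v} [MeasurableSpace O]
    (p : unitInterval) (M₁ M₂ : Kernel 𝒟 O) (D : 𝒟) :
    mixKernel p M₁ M₂ D = mixMeasure p (M₁ D) (M₂ D) :=
  rfl

instance isProbabilityMeasure_mixMeasure {O : Type v} [MeasurableSpace O] (p : unitInterval)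
    (P₁ P₂ : Measure O) [IsProbabilityMeasure P₁] [IsProbabilityMeasure P₂] :
    IsProbabilityMeasure (mixMeasure p P₁ P₂) :=
  ⟨by simp [mixMeasure, ← ENNReal.ofReal_add p.2.1 (sub_nonneg.2 p.2.2)]⟩

instance isMarkovKernel_mixKernel {𝒟 : Type u} [MeasurableSpace 𝒟] {O : Type v}
    [MeasurableSpace O] (p : unitInterval) (M₁ M₂ : Kernel 𝒟 O) [IsMarkovKernel M₁]
    [IsMarkovKernel M₂] : IsMarkovKernel (mixKernel p M₁ M₂) :=
  ⟨fun D => isProbabilityMeasure_mixMeasure p (M₁ D) (M₂ D)⟩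

theorem integral_mixMeasure {O : Type v} [MeasurableSpace O] {P₁ P₂ : Measure O}
    {p : unitInterval} {φ : O → ℝ} (h₁ : Integrable φ P₁) (h₂ : Integrable φ P₂) :
    ∫ x, φ x ∂(mixMeasure p P₁ P₂) = p * ∫ x, φ x ∂P₁ + (1 - p) * ∫ x, φ x ∂P₂ := by
  rw [mixMeasure, integral_add_measure (h₁.smul_measure ENNReal.ofReal_ne_top)
    (h₂.smul_measure ENNReal.ofReal_ne_top), integral_smul_measure, integral_smul_measure,
    ENNReal.toReal_ofReal p.2.1, ENNReal.toReal_ofReal (by linarith [p.2.2]), smul_eq_mul,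
    smul_eq_mul]

/-- For a fixed test the tested quantity is linear in the pair of measures, so its value at the
mixture is the average of two values that are at most `ε`. -/
theorem AffineTestBound.mix {O : Type v} [MeasurableSpace O] {f : ℝ → ℝ} {P₁ P₂ Q₁ Q₂ : Measure O}
    [IsFiniteMeasure P₁] [IsFiniteMeasure P₂] [IsFiniteMeasure Q₁] [IsFiniteMeasure Q₂] {ε : ℝ}
    (h₁ : AffineTestBound f P₁ Q₁ ε) (h₂ : AffineTestBound f P₂ Q₂ ε) (p : unitInterval) :
    AffineTestBound f (mixMeasure p P₁ P₂) (mixMeasure p Q₁ Q₂) ε := by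
  intro k a b φ hab hφ h0 hsum
  have hi {μ : Measure O} [IsFiniteMeasure μ] (j : Fin k) : Integrable (φ j) μ :=
    integrable_of_mem_Icc (hφ j) (h0 j) fun x =>
      (Finset.single_le_sum (fun i _ => h0 i x) (Finset.mem_univ j)).trans_eq (hsum x)
  have e₁ := mul_le_mul_of_nonneg_left (h₁ k a b φ hab hφ h0 hsum) p.2.1
  have e₂ := mul_le_mul_of_nonneg_left (h₂ k a b φ hab hφ h0 hsum) (sub_nonneg.2 p.2.2)
  have e₃ := add_le_add e₁ e₂
  rw [Finset.mul_sum, Finset.mul_sum, ← Finset.sum_add_distrib] at e₃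
  refine (Finset.sum_congr rfl fun j _ => ?_).trans_le (e₃.trans_eq (by ring))
  rw [integral_mixMeasure (hi j) (hi j), integral_mixMeasure (hi j) (hi j)]
  ring

/-- The data-processing inequality for `f`-divergences. -/
theorem fDivergence_bind_le {O : Type v} {O' : Type w} [MeasurableSpace O] [MeasurableSpace O']
    {f : ℝ → ℝ} (hf : ConvexOn ℝ (Set.Ioi 0) f) {P Q : Measure O} [IsProbabilityMeasure P]
    [IsProbabilityMeasure Q] {ε : ℝ} (h : fDivergence f P Q ≤ (ε : EReal)) (g : Kernel O O')
    [IsMarkovKernel g] : fDivergence f (P.bind g) (Q.bind g) ≤ (ε : EReal) :=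
  (fDivergence_le_iff hf).2 (((fDivergence_le_iff hf).1 h).bind g)

/-- Joint quasiconvexity of `f`-divergences. -/
theorem fDivergence_mixMeasure_le {O : Type v} [MeasurableSpace O] {f : ℝ → ℝ}
    (hf : ConvexOn ℝ (Set.Ioi 0) f) {P₁ P₂ Q₁ Q₂ : Measure O} [IsProbabilityMeasure P₁]
    [IsProbabilityMeasure P₂] [IsProbabilityMeasure Q₁] [IsProbabilityMeasure Q₂] {ε : ℝ}
    (h₁ : fDivergence f P₁ Q₁ ≤ (ε : EReal)) (h₂ : fDivergence f P₂ Q₂ ≤ (ε : EReal))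
    (p : unitInterval) :
    fDivergence f (mixMeasure p P₁ P₂) (mixMeasure p Q₁ Q₂) ≤ (ε : EReal) :=
  (fDivergence_le_iff hf).2
    (((fDivergence_le_iff hf).1 h₁).mix ((fDivergence_le_iff hf).1 h₂) p)

theorem satisfiesPrivacyAxioms_divDP {𝒟 : Type u} [MeasurableSpace 𝒟] (R : 𝒟 → 𝒟 → Prop)
    {f : ℝ → ℝ} (hf : ConvexOn ℝ (Set.Ioi 0) f) (ε : ℝ) :
    SatisfiesPrivacyAxioms (DivDP.{u, v} R f ε) := by
  refine ⟨fun O O' _ _ M _ g _ h D₁ D₂ hR => ?_, fun O _ M₁ M₂ _ _ p h₁ h₂ D₁ D₂ hR => ?_⟩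
  · rw [Kernel.comp_apply, Kernel.comp_apply]
    exact fDivergence_bind_le hf (h D₁ D₂ hR) g
  · exact fDivergence_mixMeasure_le hf (h₁ D₁ D₂ hR) (h₂ D₁ D₂ hR) p

/-! ### Kullback-Leibler and Rényi divergences as `f`-divergences -/

/-- With `f ≥ 0` and superlinear growth nothing is subtracted and `f'(∞) = ∞`; both `klFun` and `t ^
α` with `1 < α` are of this kind. -/
theorem fDivergence_of_nonneg {O : Type v} [MeasurableSpace O] {f : ℝ → ℝ} (P Q : Measure O)
    (hzero : Tendsto f (𝓝[>] 0) (𝓝 (f 0))) (htop : Tendsto (fun t => f t / t) atTop atTop)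
    (hnonneg : ∀ t, 0 ≤ t → 0 ≤ f t) :
    fDivergence f P Q = ((∫⁻ x, ENNReal.ofReal (f (P.rnDeriv Q x).toReal) ∂Q
      + ∞ * P.singularPart Q Set.univ : ℝ≥0∞) : EReal) := by
  have h0 : fAtZero f = f 0 :=
    ((continuous_coe_real_ereal.tendsto (f 0)).comp hzero).limsup_eq
  have hs : fSlopeAtTop f = ⊤ := (EReal.tendsto_coe_nhds_top_iff.2 htop).limsup_eq
  have hr (r : ℝ≥0∞) : fAtRatio f r = (f r.toReal : EReal) := by
    rw [fAtRatio]
    split_ifs with h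
    · simp [h, h0]
    · rfl
  have hp (r : ℝ≥0∞) : (fAtRatio f r).toENNReal = ENNReal.ofReal (f r.toReal) := by
    rw [hr, EReal.toENNReal_of_ne_top (EReal.coe_ne_top _), EReal.toReal_coe]
  have hn (r : ℝ≥0∞) : (-fAtRatio f r).toENNReal = 0 := by
    rw [hr, EReal.toENNReal_eq_zero_iff, ← EReal.coe_neg]
    exact EReal.coe_nonpos.2 (neg_nonpos.2 (hnonneg _ ENNReal.toReal_nonneg))
  simp only [fDivergence, hp, hn, hs, lintegral_zero, EReal.coe_ennreal_zero, sub_zero,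
    EReal.coe_ennreal_add, EReal.coe_ennreal_mul, EReal.coe_ennreal_top]

/-- The infinite slope of `klFun` reproduces the convention that `klDiv` is infinite unless `P ≪ Q`.
-/
theorem fDivergence_klFun {O : Type v} [MeasurableSpace O] (P Q : Measure O) [IsFiniteMeasure P]
    [IsFiniteMeasure Q] : fDivergence klFun P Q = ((klDiv P Q : ℝ≥0∞) : EReal) := by
  rw [fDivergence_of_nonneg P Q (continuous_klFun.continuousWithinAt) ?_
    fun t ht => klFun_nonneg ht, klDiv_eq_lintegral_klFun]
  · by_cases h : P ≪ Q
    · simp [h, Measure.singularPart_eq_zero_of_ac h]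
    · have h1 : P.singularPart Q Set.univ ≠ 0 := by
        rwa [Ne, Measure.measure_univ_eq_zero, Measure.singularPart_eq_zero]
      simp [h, ENNReal.top_mul h1]
  · have h1 : Tendsto (fun t : ℝ => Real.log t + (1 / t - 1)) atTop atTop := by
      refine Tendsto.atTop_add (C := 0 - 1) Real.tendsto_log_atTop ?_
      exact (tendsto_const_nhds.div_atTop tendsto_id).sub_const 1
    refine h1.congr' ?_
    filter_upwards [eventually_gt_atTop 0] with t ht
    rw [klFun_apply]
    field_simp
    ring

/-- The singular part lives on a `Q`-null set, where the density of `Q` vanishes while that of `P`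
is positive, almost everywhere. -/
theorem div_rnDeriv_add_ae_eq_top {O : Type v} [MeasurableSpace O] (P Q : Measure O)
    [IsFiniteMeasure P] [IsFiniteMeasure Q] :
    ∀ᵐ x ∂P.singularPart Q, P.rnDeriv (P + Q) x / Q.rnDeriv (P + Q) x = ∞ := by
  obtain ⟨N, hN, hQ, hP⟩ := (P.mutuallySingular_singularPart Q).symm
  have hle : P.singularPart Q ≪ P := (P.singularPart_le Q).absolutelyContinuous
  have hPac : P ≪ P + Q := Measure.absolutelyContinuous_of_le (Measure.le_add_right le_rfl)
  have h1 : ∀ᵐ x ∂P.singularPart Q, 0 < P.rnDeriv (P + Q) x := hle (Measure.rnDeriv_pos hPac)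
  have h2 : ∫⁻ x in N, Q.rnDeriv (P + Q) x ∂(P + Q) = 0 :=
    le_antisymm ((Measure.setLIntegral_rnDeriv_le N).trans_eq hQ) zero_le
  have h3 : ∀ᵐ x ∂(P + Q), x ∈ N → Q.rnDeriv (P + Q) x = 0 :=
    (setLIntegral_eq_zero_iff hN (Q.measurable_rnDeriv _)).1 h2
  filter_upwards [h1, hle (hPac h3), measure_eq_zero_iff_ae_notMem.1 hP] with x hx1 hx2 hx3
  rw [hx2 (not_not.1 hx3), ENNReal.div_zero hx1.ne']

/-- Write `r = dP/dQ`. On the absolutely continuous part, integrating `r ^ (α - 1)` against `P` is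
integrating `r ^ α` against `Q`; on the singular part the loss is infinite, which matches the
infinite slope of `t ^ α`. -/
theorem lintegral_exp_privacyLoss {O : Type v} [MeasurableSpace O] (P Q : Measure O)
    [IsFiniteMeasure P] [IsFiniteMeasure Q] {α : ℝ} (hα : 1 < α) :
    ((∫⁻ x, EReal.exp (((α - 1 : ℝ) : EReal) * privacyLoss P Q x) ∂P : ℝ≥0∞) : EReal) =
      fDivergence (fun t => t ^ α) P Q := by
  have hα0 : 0 < α := one_pos.trans hα
  rw [fDivergence_of_nonneg P Q ?_ ?_ fun t ht => Real.rpow_nonneg ht α]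
  · congr 1
    have hexp (x : O) : EReal.exp (((α - 1 : ℝ) : EReal) * privacyLoss P Q x) =
        (P.rnDeriv (P + Q) x / Q.rnDeriv (P + Q) x) ^ (α - 1) := by
      rw [privacyLoss, ← ENNReal.log_rpow, ENNReal.exp_log]
    simp only [hexp]
    have hm : Measurable fun x =>
        (P.rnDeriv (P + Q) x / Q.rnDeriv (P + Q) x) ^ (α - 1) :=
      ((P.measurable_rnDeriv _).div (Q.measurable_rnDeriv _)).pow_const _
    have hsplit : ∀ G : O → ℝ≥0∞, ∫⁻ x, G x ∂P =
        ∫⁻ x, G x ∂(Q.withDensity (P.rnDeriv Q)) + ∫⁻ x, G x ∂P.singularPart Q := fun G => by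
      conv_lhs => rw [P.haveLebesgueDecomposition_add Q, add_comm, lintegral_add_measure]
    rw [hsplit, lintegral_withDensity_eq_lintegral_mul _ (P.measurable_rnDeriv Q) hm]
    congr 1
    · refine lintegral_congr_ae ?_
      filter_upwards [P.rnDeriv_eq_div_rnDeriv_add Q, P.rnDeriv_lt_top Q] with x hx hlt
      rw [Pi.mul_apply, ← hx, ← ENNReal.ofReal_rpow_of_nonneg ENNReal.toReal_nonneg hα0.le,
        ENNReal.ofReal_toReal hlt.ne]
      -- Writing the factor as `r ^ 1` allows exponents to be added; both are nonnegative, so `r =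
      -- 0` needs no separate case.
      nth_rewrite 1 [← ENNReal.rpow_one (P.rnDeriv Q x)]
      rw [← ENNReal.rpow_add_of_nonneg _ _ zero_le_one (by linarith)]
      congr 1
      ring
    · rw [← lintegral_const]
      refine lintegral_congr_ae ?_
      filter_upwards [div_rnDeriv_add_ae_eq_top P Q] with x hx
      rw [hx, ENNReal.top_rpow_of_pos (by linarith)]
  · exact ((Real.continuous_rpow_const hα0.le).tendsto 0).mono_left nhdsWithin_le_nhds
  · refine (tendsto_rpow_atTop (sub_pos.2 hα)).congr' ?_
    filter_upwards [eventually_gt_atTop 0] with t ht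
    rw [Real.rpow_sub_one ht.ne']

theorem lintegral_exp_privacyLoss_le_iff {O : Type v} [MeasurableSpace O] (P Q : Measure O)
    [IsFiniteMeasure P] [IsFiniteMeasure Q] {α : ℝ} (hα : 1 < α) (c : ℝ) :
    ∫⁻ x, EReal.exp (((α - 1 : ℝ) : EReal) * privacyLoss P Q x) ∂P
        ≤ ENNReal.ofReal (Real.exp c) ↔
      fDivergence (fun t => t ^ α) P Q ≤ (Real.exp c : EReal) := by
  rw [← lintegral_exp_privacyLoss P Q hα, ← EReal.coe_ennreal_le_coe_ennreal_iff,
    EReal.coe_ennreal_ofReal, max_eq_left (Real.exp_pos c).le]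

theorem convexOn_rpow_Ioi {α : ℝ} (hα : 1 < α) : ConvexOn ℝ (Set.Ioi 0) fun t : ℝ => t ^ α :=
  (convexOn_rpow hα.le).subset Set.Ioi_subset_Ici_self (convex_Ioi 0)

/-- Equivalence on Markov kernels suffices because post-processing and mixing preserve them; the
divergence identities above are for finite measures. -/
theorem SatisfiesPrivacyAxioms.congr {𝒟 : Type u} [MeasurableSpace 𝒟]
    {Def Def' : PrivacyDefinition.{u, v} 𝒟} (h : SatisfiesPrivacyAxioms Def)
    (hiff : ∀ (O : Type v) [MeasurableSpace O] (M : Kernel 𝒟 O) [IsMarkovKernel M],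
      Def O M ↔ Def' O M) : SatisfiesPrivacyAxioms Def' :=
  ⟨fun O O' _ _ M _ g _ hM => (hiff O' _).1 (h.1 O O' M g ((hiff O M).2 hM)),
    fun O _ M₁ M₂ _ _ p h₁ h₂ =>
      (hiff O _).1 (h.2 O M₁ M₂ p ((hiff O M₁).2 h₁) ((hiff O M₂).2 h₂))⟩

theorem satisfiesPrivacyAxioms_klPrivacy {𝒟 : Type u} [MeasurableSpace 𝒟] (R : 𝒟 → 𝒟 → Prop)
    (ε : ℝ) : SatisfiesPrivacyAxioms (KLPrivacy.{u, v} R ε) := by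
  refine (satisfiesPrivacyAxioms_divDP.{u, v} R convexOn_Ioi_klFun ε).congr fun O _ M _ => ?_
  simp only [DivDP, KLPrivacy, fDivergence_klFun]

theorem satisfiesPrivacyAxioms_renyiDP {𝒟 : Type u} [MeasurableSpace 𝒟] (R : 𝒟 → 𝒟 → Prop)
    {α : ℝ} (hα : 1 < α) (ε : ℝ) : SatisfiesPrivacyAxioms (RenyiDP.{u, v} R α ε) := by
  refine (satisfiesPrivacyAxioms_divDP.{u, v} R (convexOn_rpow_Ioi hα)
    (Real.exp ((α - 1) * ε))).congr fun O _ M _ => ?_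
  simp only [DivDP, RenyiDP, lintegral_exp_privacyLoss_le_iff _ _ hα]

/-- For each fixed `α` the condition is Rényi DP with parameter `ξ + ρ * α`, and both axioms pass to
intersections. -/
theorem satisfiesPrivacyAxioms_zeroConcentratedDP {𝒟 : Type u} [MeasurableSpace 𝒟]
    (R : 𝒟 → 𝒟 → Prop) (ξ ρ : ℝ) :
    SatisfiesPrivacyAxioms (ZeroConcentratedDP.{u, v} R ξ ρ) := by
  refine ⟨fun O O' _ _ M _ g _ h D₁ D₂ hR α hα => ?_,
    fun O _ M₁ M₂ _ _ p h₁ h₂ D₁ D₂ hR α hα => ?_⟩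
  · exact (satisfiesPrivacyAxioms_renyiDP R hα (ξ + ρ * α)).1 O O' M g
      (fun D₁ D₂ hR => h D₁ D₂ hR α hα) D₁ D₂ hR
  · exact (satisfiesPrivacyAxioms_renyiDP R hα (ξ + ρ * α)).2 O M₁ M₂ p
      (fun D₁ D₂ hR => h₁ D₁ D₂ hR α hα) (fun D₁ D₂ hR => h₂ D₁ D₂ hR α hα) D₁ D₂ hR

/-! ### Approximate differential privacy -/

/-- Among `[0, 1]`-valued tests the integral against `P - ν` is largest for the indicator of the
positive set of a Hahn decomposition, and there the hypothesis on events applies. -/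
theorem integral_sub_integral_le_of_forall_measurableSet {O : Type v} [MeasurableSpace O]
    {P ν : Measure O} [IsFiniteMeasure P] [IsFiniteMeasure ν] {δ : ℝ}
    (h : ∀ S, MeasurableSet S → P.real S ≤ ν.real S + δ) {φ : O → ℝ} (hφ : Measurable φ)
    (h0 : ∀ x, 0 ≤ φ x) (h1 : ∀ x, φ x ≤ 1) : ∫ x, φ x ∂P ≤ ∫ x, φ x ∂ν + δ := by
  obtain ⟨s, hs, hpos, hneg⟩ := hahn_decomposition P ν
  have hi {μ : Measure O} [IsFiniteMeasure μ] : Integrable φ μ := integrable_of_mem_Icc hφ h0 h1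
  have hle : ν.restrict s ≤ P.restrict s := Measure.le_iff.2 fun t ht => by
    rw [Measure.restrict_apply ht, Measure.restrict_apply ht]
    exact hpos _ (ht.inter hs) Set.inter_subset_right
  have hle' : P.restrict sᶜ ≤ ν.restrict sᶜ := Measure.le_iff.2 fun t ht => by
    rw [Measure.restrict_apply ht, Measure.restrict_apply ht]
    exact hneg _ (ht.inter hs.compl) Set.inter_subset_right
  -- On `s` raising `φ` to `1` does not lower the difference; on `sᶜ` lowering it to `0` does not
  -- either.
  have e₁ : ∫ x in s, (1 - φ x) ∂ν ≤ ∫ x in s, (1 - φ x) ∂P :=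
    integral_mono_measure hle (ae_of_all _ fun x => sub_nonneg.2 (h1 x))
      ((integrable_const 1).sub hi)
  have e₂ : ∫ x in sᶜ, φ x ∂P ≤ ∫ x in sᶜ, φ x ∂ν :=
    integral_mono_measure hle' (ae_of_all _ h0) hi
  rw [integral_sub (integrable_const 1) hi, integral_sub (integrable_const 1) hi] at e₁
  simp only [integral_const, measureReal_restrict_apply_univ, smul_eq_mul, mul_one] at e₁
  rw [← integral_add_compl hs (hi (μ := P)), ← integral_add_compl hs (hi (μ := ν))]
  linarith [h s hs]

theorem satisfiesPrivacyAxioms_approxDP {𝒟 : Type u} [MeasurableSpace 𝒟] (R : 𝒟 → 𝒟 → Prop)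
    (ε δ : ℝ) : SatisfiesPrivacyAxioms (ApproxDP.{u, v} R ε δ) := by
  refine ⟨fun O O' _ _ M _ g _ h D₁ D₂ hR S hS => ?_,
    fun O _ M₁ M₂ _ _ p h₁ h₂ D₁ D₂ hR S hS => ?_⟩
  · have hcomp (D : 𝒟) : ((g ∘ₖ M) D).real S = ∫ x, (g x).real S ∂M D := by
      have hi : Integrable (S.indicator (1 : O' → ℝ)) ((g ∘ₖ M) D) :=
        (integrable_const (1 : ℝ)).indicator hS
      rw [← integral_indicator_one hS, Kernel.integral_comp hi]
      simp only [integral_indicator_one hS]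
    have hfin : IsFiniteMeasure (ENNReal.ofReal (Real.exp ε) • M D₂) :=
      Measure.smul_finite _ ENNReal.ofReal_ne_top
    -- The event `S` after post-processing is the test `x ↦ (g x).real S` before it, which need not
    -- be an indicator.
    have h1 := integral_sub_integral_le_of_forall_measurableSet (P := M D₁)
      (ν := ENNReal.ofReal (Real.exp ε) • M D₂) (δ := δ)
      (fun S hS => by
        simpa [measureReal_ennreal_smul_apply, (Real.exp_pos ε).le] using h D₁ D₂ hR S hS)
      (g.measurable_coe hS).ennreal_toReal (fun x => ENNReal.toReal_nonneg)
      (fun x => measureReal_le_one (μ := g x))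
    rw [hcomp, hcomp]
    rw [integral_smul_measure, ENNReal.toReal_ofReal (Real.exp_pos ε).le] at h1
    exact h1
  · have hmix (D : 𝒟) : (mixKernel p M₁ M₂ D).real S =
        p * (M₁ D).real S + (1 - p) * (M₂ D).real S := by
      have hi {μ : Measure O} [IsFiniteMeasure μ] : Integrable (S.indicator (1 : O → ℝ)) μ :=
        (integrable_const (1 : ℝ)).indicator hS
      simp only [← integral_indicator_one hS]
      rw [mixKernel_apply, integral_mixMeasure hi hi]
    rw [hmix, hmix]
    nlinarith [mul_le_mul_of_nonneg_left (h₁ D₁ D₂ hR S hS) p.2.1,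
      mul_le_mul_of_nonneg_left (h₂ D₁ D₂ hR S hS) (sub_nonneg.2 p.2.2)]

/-! ### Mutual-information privacy -/

theorem lintegral_mixMeasure (p : unitInterval) {X : Type*} [MeasurableSpace X]
    (P₁ P₂ : Measure X) (F : X → ℝ≥0∞) :
    ∫⁻ x, F x ∂mixMeasure p P₁ P₂ =
      ENNReal.ofReal p * ∫⁻ x, F x ∂P₁ + ENNReal.ofReal (1 - p) * ∫⁻ x, F x ∂P₂ := by
  rw [mixMeasure, lintegral_add_measure, lintegral_smul_measure, lintegral_smul_measure,
    smul_eq_mul, smul_eq_mul]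

theorem lintegral_mul_add_mul {X : Type*} [MeasurableSpace X] {μ : Measure X} (a b : ℝ≥0∞)
    {F G : X → ℝ≥0∞} (hF : Measurable F) (hG : Measurable G) :
    ∫⁻ x, (a * F x + b * G x) ∂μ = a * ∫⁻ x, F x ∂μ + b * ∫⁻ x, G x ∂μ := by
  rw [lintegral_add_left (hF.const_mul a), lintegral_const_mul _ hF, lintegral_const_mul _ hG]

theorem measure_compProd_mixKernel {X : Type*} {Y : Type*} [MeasurableSpace X] [MeasurableSpace Y]
    (μ : Measure X) [SFinite μ] (p : unitInterval) (κ κ' : Kernel X Y) [IsMarkovKernel κ]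
    [IsMarkovKernel κ'] :
    μ ⊗ₘ mixKernel p κ κ' = mixMeasure p (μ ⊗ₘ κ) (μ ⊗ₘ κ') := by
  refine Measure.ext_of_lintegral _ fun F hF => ?_
  simp only [lintegral_mixMeasure, Measure.lintegral_compProd hF, mixKernel_apply]
  exact lintegral_mul_add_mul _ _ hF.lintegral_kernel_prod_right' hF.lintegral_kernel_prod_right'

theorem prod_mixKernel {X Y Z : Type*} [MeasurableSpace X] [MeasurableSpace Y] [MeasurableSpace Z]
    (p : unitInterval) (η : Kernel X Y) [IsMarkovKernel η] (κ κ' : Kernel X Z) [IsMarkovKernel κ]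
    [IsMarkovKernel κ'] : η ×ₖ mixKernel p κ κ' = mixKernel p (η ×ₖ κ) (η ×ₖ κ') := by
  refine Kernel.ext fun x => Measure.ext_of_lintegral _ fun F hF => ?_
  simp only [lintegral_mixMeasure, Kernel.lintegral_prod _ _ _ hF, mixKernel_apply]
  exact lintegral_mul_add_mul _ _ hF.lintegral_prod_right' hF.lintegral_prod_right'

theorem mixKernel_comp {X Y Z : Type*} [MeasurableSpace X] [MeasurableSpace Y] [MeasurableSpace Z]
    (p : unitInterval) (κ κ' : Kernel Y Z) (η : Kernel X Y) :
    mixKernel p κ κ' ∘ₖ η = mixKernel p (κ ∘ₖ η) (κ' ∘ₖ η) := by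
  refine Kernel.ext fun x => Measure.ext_of_lintegral _ fun F hF => ?_
  simp only [lintegral_mixMeasure, Kernel.lintegral_comp _ _ _ hF, mixKernel_apply]
  exact lintegral_mul_add_mul _ _ hF.lintegral_kernel hF.lintegral_kernel

/-- This kernel keeps the records and randomises only the output; it expresses post-processing at
the level of joint laws. -/
theorem lintegral_bind_parallelComp_id {X Y Z W : Type*} [MeasurableSpace X] [MeasurableSpace Y]
    [MeasurableSpace Z] [MeasurableSpace W] (g : Kernel Z W) [IsMarkovKernel g]
    {μ : Measure (X × Y × Z)} {F : X × Y × W → ℝ≥0∞} (hF : Measurable F) :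
    ∫⁻ z, F z ∂μ.bind ((Kernel.id : Kernel X X) ∥ₖ ((Kernel.id : Kernel Y Y) ∥ₖ g)) =
      ∫⁻ z, ∫⁻ o, F (z.1, z.2.1, o) ∂g z.2.2 ∂μ := by
  rw [Measure.lintegral_bind (Kernel.aemeasurable _) hF.aemeasurable]
  refine lintegral_congr fun z => ?_
  have hF' : Measurable fun q => F (z.1, q) := hF.comp measurable_prodMk_left
  rw [Kernel.lintegral_parallelComp _ hF, Kernel.lintegral_id' hF.lintegral_prod_right',
    Kernel.lintegral_parallelComp _ hF', Kernel.lintegral_id' hF'.lintegral_prod_right']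

theorem measurable_lintegral_kernel_snd_snd {X Y Z W : Type*} [MeasurableSpace X]
    [MeasurableSpace Y] [MeasurableSpace Z] [MeasurableSpace W] (g : Kernel Z W) [IsMarkovKernel g]
    {F : X × Y × W → ℝ≥0∞} (hF : Measurable F) :
    Measurable fun z : X × Y × Z => ∫⁻ o, F (z.1, z.2.1, o) ∂g z.2.2 :=
  Measurable.lintegral_kernel_prod_right'
    (κ := g.comap (fun z : X × Y × Z => z.2.2) (measurable_snd.comp measurable_snd))
    (f := fun q => F (q.1.1, q.1.2.1, q.2)) (hF.comp (by fun_prop))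

theorem measurable_removeNth {T : Type w} [MeasurableSpace T] {n : ℕ} (i : Fin (n + 1)) :
    Measurable fun D : Fin (n + 1) → T => i.removeNth D :=
  measurable_pi_lambda _ fun j => measurable_pi_apply (i.succAbove j)

theorem measurable_splitRecord {T : Type w} [MeasurableSpace T] {O : Type v}
    [MeasurableSpace O] {n : ℕ} (i : Fin (n + 1)) :
    Measurable fun q : (Fin (n + 1) → T) × O => (i.removeNth q.1, q.1 i, q.2) :=
  ((measurable_removeNth i).comp measurable_fst).prodMk
    (((measurable_pi_apply i).comp measurable_fst).prodMk measurable_snd)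

section JointLaw

variable {T : Type w} [MeasurableSpace T] {O : Type v} [MeasurableSpace O] {n : ℕ}

instance isMarkovKernel_mechOnSize (M : Kernel (Dataset T) O) [IsMarkovKernel M] :
    IsMarkovKernel (mechOnSize M n) := by
  unfold mechOnSize
  infer_instance

/-- The joint law of `(D_{-i}, D(i), M(D))` for `D ∼ θ`. -/
noncomputable def jointLaw (M : Kernel (Dataset T) O) (θ : Measure (Fin (n + 1) → T))
    (i : Fin (n + 1)) : Measure ((Fin n → T) × T × O) :=
  (θ ⊗ₘ mechOnSize M (n + 1)).map
    (fun q : (Fin (n + 1) → T) × O => (i.removeNth q.1, q.1 i, q.2))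

variable (M M' : Kernel (Dataset T) O) [IsMarkovKernel M] [IsMarkovKernel M']
  (θ : Measure (Fin (n + 1) → T)) [IsProbabilityMeasure θ] (i : Fin (n + 1))

instance isProbabilityMeasure_jointLaw : IsProbabilityMeasure (jointLaw M θ i) :=
  Measure.isProbabilityMeasure_map (measurable_splitRecord i).aemeasurable

theorem lintegral_jointLaw {F : (Fin n → T) × T × O → ℝ≥0∞} (hF : Measurable F) :
    ∫⁻ z, F z ∂jointLaw M θ i = ∫⁻ D, ∫⁻ o, F (i.removeNth D, D i, o) ∂M ⟨n + 1, D⟩ ∂θ := by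
  rw [jointLaw, lintegral_map hF (measurable_splitRecord i),
    Measure.lintegral_compProd (f := fun q : (Fin (n + 1) → T) × O => F (i.removeNth q.1, q.1 i, q.2))
      (hF.comp (measurable_splitRecord i))]
  simp only [mechOnSize, Kernel.comap_apply]

theorem jointLaw_comp {O' : Type v} [MeasurableSpace O'] (g : Kernel O O') [IsMarkovKernel g] :
    jointLaw (g ∘ₖ M) θ i = (jointLaw M θ i).bind
      ((Kernel.id : Kernel (Fin n → T) _) ∥ₖ ((Kernel.id : Kernel T T) ∥ₖ g)) := by
  refine Measure.ext_of_lintegral _ fun F hF => ?_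
  rw [lintegral_bind_parallelComp_id g hF, lintegral_jointLaw _ θ i hF,
    lintegral_jointLaw M θ i (measurable_lintegral_kernel_snd_snd g hF)]
  refine lintegral_congr fun D => ?_
  exact Kernel.lintegral_comp _ _ _
    (hF.comp (measurable_prodMk_left.comp measurable_prodMk_left))

theorem jointLaw_mixKernel (p : unitInterval) :
    jointLaw (mixKernel p M M') θ i = mixMeasure p (jointLaw M θ i) (jointLaw M' θ i) := by
  have h : mechOnSize (mixKernel p M M') (n + 1) =
      mixKernel p (mechOnSize M (n + 1)) (mechOnSize M' (n + 1)) := rfl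
  simp only [jointLaw, h, measure_compProd_mixKernel]
  simp only [mixMeasure, Measure.map_add _ _ (measurable_splitRecord i), Measure.map_smul]

end JointLaw

section CondIndepLaw

variable {T : Type w} [MeasurableSpace T] [StandardBorelSpace T] [Nonempty T] {O : Type v}
  [MeasurableSpace O] {n : ℕ}

instance isMarkovKernel_recordGivenRest (θ : Measure (Fin (n + 1) → T)) [IsProbabilityMeasure θ]
    (i : Fin (n + 1)) : IsMarkovKernel (recordGivenRest θ i) := by
  unfold recordGivenRest
  infer_instance

instance isMarkovKernel_outputGivenRest (M : Kernel (Dataset T) O) [IsMarkovKernel M]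
    (θ : Measure (Fin (n + 1) → T)) [IsProbabilityMeasure θ] (i : Fin (n + 1)) :
    IsMarkovKernel (outputGivenRest M θ i) := by
  unfold outputGivenRest
  infer_instance

/-- The law under which `D(i)` and `M(D)` are conditionally independent given `D_{-i}`. -/
noncomputable def condIndepLaw (M : Kernel (Dataset T) O) (θ : Measure (Fin (n + 1) → T))
    [IsProbabilityMeasure θ] (i : Fin (n + 1)) : Measure ((Fin n → T) × T × O) :=
  (θ.map (fun D => i.removeNth D)) ⊗ₘ (recordGivenRest θ i ×ₖ outputGivenRest M θ i)

theorem lintegral_outputGivenRest (M : Kernel (Dataset T) O) (θ : Measure (Fin (n + 1) → T))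
    [IsProbabilityMeasure θ] (i : Fin (n + 1)) {F : O → ℝ≥0∞} (hF : Measurable F) (y : Fin n → T) :
    ∫⁻ o, F o ∂outputGivenRest M θ i y =
      ∫⁻ t, ∫⁻ o, F o ∂M (insertRecord i (y, t)) ∂recordGivenRest θ i y := by
  rw [outputGivenRest, Kernel.lintegral_comp _ _ _ hF, Kernel.lintegral_id_prod]
  · simp only [Kernel.comap_apply]
  · exact hF.lintegral_kernel

variable (M M' : Kernel (Dataset T) O) [IsMarkovKernel M] [IsMarkovKernel M']
  (θ : Measure (Fin (n + 1) → T)) [IsProbabilityMeasure θ] (i : Fin (n + 1))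

instance isProbabilityMeasure_condIndepLaw : IsProbabilityMeasure (condIndepLaw M θ i) := by
  have := Measure.isProbabilityMeasure_map (μ := θ) (measurable_removeNth i).aemeasurable
  unfold condIndepLaw
  infer_instance

theorem lintegral_condIndepLaw {F : (Fin n → T) × T × O → ℝ≥0∞} (hF : Measurable F) :
    ∫⁻ z, F z ∂condIndepLaw M θ i =
      ∫⁻ y, ∫⁻ t, ∫⁻ s, ∫⁻ o, F (y, t, o) ∂M (insertRecord i (y, s)) ∂recordGivenRest θ i y
        ∂recordGivenRest θ i y ∂θ.map (fun D => i.removeNth D) := by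
  rw [condIndepLaw, Measure.lintegral_compProd hF]
  refine lintegral_congr fun y => ?_
  rw [Kernel.lintegral_prod _ _ _ (g := fun q => F (y, q)) (hF.comp measurable_prodMk_left)]
  refine lintegral_congr fun t => ?_
  exact lintegral_outputGivenRest M θ i
    (hF.comp (measurable_prodMk_left.comp measurable_prodMk_left)) y

theorem condIndepLaw_comp {O' : Type v} [MeasurableSpace O'] (g : Kernel O O')
    [IsMarkovKernel g] :
    condIndepLaw (g ∘ₖ M) θ i = (condIndepLaw M θ i).bind
      ((Kernel.id : Kernel (Fin n → T) _) ∥ₖ ((Kernel.id : Kernel T T) ∥ₖ g)) := by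
  refine Measure.ext_of_lintegral _ fun F hF => ?_
  rw [lintegral_bind_parallelComp_id g hF, lintegral_condIndepLaw _ θ i hF,
    lintegral_condIndepLaw M θ i (measurable_lintegral_kernel_snd_snd g hF)]
  refine lintegral_congr fun y => lintegral_congr fun t => lintegral_congr fun s => ?_
  exact Kernel.lintegral_comp _ _ _
    (hF.comp (measurable_prodMk_left.comp measurable_prodMk_left))

/-- `recordGivenRest` depends on the prior alone, so the mechanism enters only once, through the
conditional law of the output, and enters affinely. A product of two factors that both varied with
the mechanism would not be affine. -/
theorem condIndepLaw_mixKernel (p : unitInterval) :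
    condIndepLaw (mixKernel p M M') θ i =
      mixMeasure p (condIndepLaw M θ i) (condIndepLaw M' θ i) := by
  have hcomap : (mixKernel p M M').comap (insertRecord i) (measurable_insertRecord i) =
      mixKernel p (M.comap (insertRecord i) (measurable_insertRecord i))
        (M'.comap (insertRecord i) (measurable_insertRecord i)) := rfl
  have h : outputGivenRest (mixKernel p M M') θ i =
      mixKernel p (outputGivenRest M θ i) (outputGivenRest M' θ i) := by
    simp only [outputGivenRest, hcomap, mixKernel_comp]
  simp only [condIndepLaw, h, prod_mixKernel, measure_compProd_mixKernel]

end CondIndepLaw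

/-- For each fixed prior and record, both arguments of `klDiv` transform under the same kernel or
the same mixture, so data processing and joint quasiconvexity for `klFun` apply. -/
theorem satisfiesPrivacyAxioms_miPrivacy (T : Type w) [MeasurableSpace T] [StandardBorelSpace T]
    [Nonempty T] (ε : ℝ) : SatisfiesPrivacyAxioms (MIPrivacy.{v, w} T ε) := by
  refine ⟨fun O O' _ _ M _ g _ h n θ _ i => ?_, fun O _ M₁ M₂ _ _ p h₁ h₂ n θ _ i => ?_⟩
  · have h := h n θ i
    change ((klDiv (jointLaw M θ i) (condIndepLaw M θ i) : ℝ≥0∞) : EReal) ≤ ε at h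
    change ((klDiv (jointLaw (g ∘ₖ M) θ i) (condIndepLaw (g ∘ₖ M) θ i) : ℝ≥0∞) : EReal) ≤ ε
    rw [jointLaw_comp, condIndepLaw_comp, ← fDivergence_klFun]
    rw [← fDivergence_klFun] at h
    exact fDivergence_bind_le convexOn_Ioi_klFun h _
  · have h₁ := h₁ n θ i
    have h₂ := h₂ n θ i
    change ((klDiv (jointLaw M₁ θ i) (condIndepLaw M₁ θ i) : ℝ≥0∞) : EReal) ≤ ε at h₁
    change ((klDiv (jointLaw M₂ θ i) (condIndepLaw M₂ θ i) : ℝ≥0∞) : EReal) ≤ ε at h₂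
    change ((klDiv (jointLaw (mixKernel p M₁ M₂) θ i)
      (condIndepLaw (mixKernel p M₁ M₂) θ i) : ℝ≥0∞) : EReal) ≤ ε
    rw [jointLaw_mixKernel, condIndepLaw_mixKernel, ← fDivergence_klFun]
    rw [← fDivergence_klFun] at h₁ h₂
    exact fDivergence_mixMeasure_le convexOn_Ioi_klFun h₁ h₂ p

theorem mainTheorem1 {𝒟 : Type u} [MeasurableSpace 𝒟] (R : 𝒟 → 𝒟 → Prop)
    (T : Type w) [MeasurableSpace T] [StandardBorelSpace T] [Nonempty T] :
    (∀ f : ℝ → ℝ, ConvexOn ℝ (Set.Ioi 0) f → f 1 = 0 → ∀ ε : ℝ,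
      SatisfiesPrivacyAxioms (DivDP.{u, v} R f ε)) ∧
    (∀ ε δ : ℝ, SatisfiesPrivacyAxioms (ApproxDP.{u, v} R ε δ)) ∧
    (∀ ε : ℝ, SatisfiesPrivacyAxioms (MIPrivacy.{v, w} T ε)) ∧
    (∀ ε : ℝ, SatisfiesPrivacyAxioms (KLPrivacy.{u, v} R ε)) ∧
    (∀ α ε : ℝ, 1 < α → SatisfiesPrivacyAxioms (RenyiDP.{u, v} R α ε)) ∧
    (∀ ξ ρ : ℝ, SatisfiesPrivacyAxioms (ZeroConcentratedDP.{u, v} R ξ ρ)) :=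
  ⟨fun _ hf _ ε => satisfiesPrivacyAxioms_divDP R hf ε, satisfiesPrivacyAxioms_approxDP R,
    satisfiesPrivacyAxioms_miPrivacy T, satisfiesPrivacyAxioms_klPrivacy R,
    fun _ ε hα => satisfiesPrivacyAxioms_renyiDP R hα ε, satisfiesPrivacyAxioms_zeroConcentratedDP R⟩
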